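/- Let $k,j$ be fixed integers with $1\le j\le k-1$. Let $H^k(n,p)$ be the random $k$-uniform hypergraph on $n$ labelled vertices in which each of the $\binom nk$ $k$-element vertex sets is an edge independently with probability $p$. Two $j$-element vertex sets $J,J'$ are $j$-tuple-connected in a $k$-uniform hypergraph $H$ if there are $m\ge 0$, $j$-element vertex sets $J=J_0,J_1,\dots,J_m=J'$ and edges $h_0,\dots,h_{m-1}$ of $H$ with $J_i\cup J_{i+1}\subseteq h_i$ for all $0\le i<m$. The classes of this equivalence relation are the $j$-tuple-connected components of $H$; the size of a component is the number of $j$-sets in it. Put $$p_{k,j}=p_{k,j}(n)=\frac{(k-j)!}{\binom kj-1}\,n^{j-k}.$$ "A.a.s." means with probability tending to $1$ as $n\to\infty$. In both parts $\varepsilon=\varepsilon(n)>0$ may depend on $n$ and is such that the given $p$ lies in $[0,1]$ for all sufficiently large $n$. (i) There is a constant $C>0$ depending only on $k$ and $j$ such that for every such $\varepsilon$, if $p=(1-\varepsilon)p_{k,j}$, then a.a.s. every $j$-tuple-connected component of $H^k(n,p)$ has size at most $C\varepsilon^{-2}\log n$. (ii) There is a constant $c>0$ depending only on $k$ and $j$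 such that for every constant $\delta\in(0,1)$ and every such $\varepsilon$ with $\varepsilon/(n^{\delta-1}+n^{-j/3})\to\infty$ as $n\to\infty$, if $p=(1+\varepsilon)p_{k,j}$, then a.a.s. some $j$-tuple-connected component of $H^k(n,p)$ has size at least $c\min(\varepsilon,1)\,n^j$. In particular, the largest component a.a.s. has size $\Omega(\varepsilon n^j)$ whenever $\varepsilon$ is bounded. -/

import Mathlib

open Filter Topology MeasureTheory ProbabilityTheory

/-- A `k`-uniform hypergraph on the vertex set `V`, given by its edge set, which is a set of
`k`-element subsets of `V`. -/
abbrev UniformHypergraph (V : Type*) (k : ℕ) : Type _ := Set {e : Finset V // e.card = k}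

namespace UniformHypergraph

variable {V : Type*} {k : ℕ}

/-- One step of a walk on `j`-sets: the `j`-sets `J` and `J'` lie in a common edge of `H`. -/
def TupleAdj (H : UniformHypergraph V k) (j : ℕ) (J J' : {s : Finset V // s.card = j}) : Prop :=
  ∃ h ∈ H, (J : Finset V) ⊆ h ∧ (J' : Finset V) ⊆ h

/-- `J` and `J'` are `j`-tuple-connected in `H`: there is an alternating sequence
`J = J₀, h₀, J₁, h₁, …, Jₘ = J'` of `j`-sets and edges of `H` (possibly with `m = 0`) such that
`Jᵢ ∪ Jᵢ₊₁ ⊆ hᵢ` for all `i < m`. -/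
def TupleConnected (H : UniformHypergraph V k) (j : ℕ) :
    {s : Finset V // s.card = j} → {s : Finset V // s.card = j} → Prop :=
  Relation.ReflTransGen (H.TupleAdj j)

theorem TupleAdj.symm {H : UniformHypergraph V k} {j : ℕ} {J J' : {s : Finset V // s.card = j}}
    (h : H.TupleAdj j J J') : H.TupleAdj j J' J := by
  obtain ⟨e, he, h1, h2⟩ := h
  exact ⟨e, he, h2, h1⟩

/-- `j`-tuple-connectedness as an equivalence relation on the `j`-subsets of `V`. -/
def tupleSetoid (H : UniformHypergraph V k) (j : ℕ) : Setoid {s : Finset V // s.card = j} where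
  r := H.TupleConnected j
  iseqv :=
    { refl := fun _ => Relation.ReflTransGen.refl
      symm := fun h => by
        induction h with
        | refl => exact Relation.ReflTransGen.refl
        | tail _ h' ih => exact Relation.ReflTransGen.head h'.symm ih
      trans := fun h h' => Relation.ReflTransGen.trans h h' }

/-- The `j`-tuple-connected components of `H`; each of them is a set of `j`-sets. -/
def tupleComponents (H : UniformHypergraph V k) (j : ℕ) :
    Set (Set {s : Finset V // s.card = j}) :=
  (H.tupleSetoid j).classes

end UniformHypergraph

/-- The distribution of the binomial random `k`-uniform hypergraph `H^k(n,p)` on `n` vertices: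
each `k`-subset of the vertex set is an edge with probability `p`, independently. -/
noncomputable def randomHypergraph (k n : ℕ) (p : unitInterval) :
    Measure (UniformHypergraph (Fin n) k) :=
  setBernoulli Set.univ p

/-- The threshold `p_{k,j}(n) = (k-j)! / (binom(k,j) - 1) * n^(j-k)`. -/
noncomputable def thresholdProb (k j n : ℕ) : ℝ :=
  ((k - j).factorial : ℝ) / ((k.choose j : ℝ) - 1) * (n : ℝ) ^ ((j : ℤ) - (k : ℤ))

/-- The sequence of events `A n`, concerning the random hypergraphs `H^k(n, p n)`, holds
asymptotically almost surely: its probability tends to `1` as `n → ∞`. -/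
def HoldsAAS (k : ℕ) (p : ℕ → unitInterval)
    (A : (n : ℕ) → UniformHypergraph (Fin n) k → Prop) : Prop :=
  Tendsto (fun n => randomHypergraph k n (p n) {H | A n H}) atTop (𝓝 1)

/-!
Both parts come from exploring the random hypergraph one `k`-set at a time. Whenever a discovered
`j`-set `J` lies in an edge that is found, at most `r = k.choose j - 1` further `j`-sets are
discovered, and `J` lies in about `n ^ (k - j) / (k - j)!` sets of size `k`; so `thresholdProb` is
the edge probability at which the exploration has mean offspring one.

All probabilistic estimates are instances of one exponential supermartingale
(`SearchRule.measureReal_potential_le`): no `k`-set is queried twice, so for every weight `g` on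
queries, `exp (∑_{found} g - p ∑_{queried} (exp g - 1))` has mean at most one.

*Below the threshold*, explore the component of a fixed `j`-set until `m` sets are discovered. This
takes at least `(m - 1) / r` edges among at most about `m * n ^ (k - j) / (k - j)!` queries. With the
constant weight `g = ε / 2` this has probability at most a constant times
`exp (-ε ^ 2 * m / (4 * r))` (`component_tail_le`), and a union bound over the `j`-sets finishes
the proof.

*Above the threshold*, one may take `ε` to be small, as having a large component is a monotone
property. The search takes one seed after another and only queries `k`-sets that contain exactly one
discovered `j`-set, so every edge found contributes exactly `r` new sets. It stops once
`B = c * ε * n ^ j` sets are discovered, or some `i`-set, `1 ≤ i < j`, lies in too many discovered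
`j`-sets. As long as all these degrees are bounded, only a small multiple of `ε * n ^ (k - j)` of
the `k`-sets above a discovered `j`-set contain another one. Hence, when the search runs out of
queries and needs a new seed, the number of queries so far exceeds `(1 + ε / 2)` times the number of
queries in which one expects as many edges as were found (`card_discovered_le_of_idle`). By the
supermartingale with `g = -ε / 8` this does not happen late in the search (`idle_tail_le`), where
the error probability `exp (-c' * ε ^ 3 * n ^ j)` tends to zero by the assumption on
`ε / n ^ (-j / 3)`. So the last three quarters of the `B` sets belong to one component.

It remains to see that the degrees stay bounded (`degree_tail_le`). The discovered sets above a
nonempty set `L` have a mean offspring above `L` of at most about `(r - 1) / r`, so their number is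
comparable to the number of times that the search enters the sets above `L`, which is controlled by
the degrees of the proper subsets of `L`; hence the thresholds `degreeThreshold`, which grow by a
constant factor with each element of `L`. Here the weight `g` is a multiple of the number of new
`j`-sets above `L`, and the error probability `exp (-c' * ε * n)` is negligible against the number
of sets `L` because `ε * n ≥ n ^ δ`. The seeds come from a family of `j`-sets in which no set `L`
has a large degree (`exists_spread_family`).
-/

/-! ### Finite Bernoulli expectations -/

/-- The expectation of `f H`, where the random set `H` contains each element of the finite set `s`
independently with probability `p`. -/
noncomputable def bernoulliSum {E : Type*} (p : ℝ) (s : Finset E) (f : Set E → ℝ) : ℝ :=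
  ∑ H ∈ s.powerset, p ^ H.card * (1 - p) ^ (s.card - H.card) * f H

section BernoulliSum

variable {E : Type*} {p : ℝ}

theorem bernoulliSum_const (s : Finset E) (c : ℝ) : bernoulliSum p s (fun _ => c) = c := by
  unfold bernoulliSum
  rw [← Finset.sum_mul, Finset.sum_pow_mul_eq_add_pow]
  simp

theorem bernoulliSum_mono (hp0 : 0 ≤ p) (hp1 : p ≤ 1) (s : Finset E) {f g : Set E → ℝ}
    (hfg : ∀ H, f H ≤ g H) : bernoulliSum p s f ≤ bernoulliSum p s g := by
  refine Finset.sum_le_sum fun H _ => mul_le_mul_of_nonneg_left (hfg H) ?_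
  have : 0 ≤ 1 - p := by linarith
  positivity

/-- Conditioning on whether `a` belongs to the random set. -/
theorem bernoulliSum_insert [DecidableEq E] {s : Finset E} {a : E} (ha : a ∉ s)
    (f : Set E → ℝ) :
    bernoulliSum p (insert a s) f =
      (1 - p) * bernoulliSum p s f + p * bernoulliSum p s (fun H => f (insert a H)) := by
  unfold bernoulliSum
  rw [Finset.sum_powerset_insert ha, Finset.mul_sum, Finset.mul_sum]
  congr 1
  · refine Finset.sum_congr rfl fun H hH => ?_
    have h1 : H.card ≤ s.card := Finset.card_le_card (Finset.mem_powerset.1 hH)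
    rw [Finset.card_insert_of_notMem ha, Nat.succ_sub h1, pow_succ]
    ring
  · refine Finset.sum_congr rfl fun H hH => ?_
    have h1 : H ⊆ s := Finset.mem_powerset.1 hH
    rw [Finset.card_insert_of_notMem ha, Finset.card_insert_of_notMem (fun h => ha (h1 h)),
      Nat.succ_sub_succ, pow_succ, Finset.coe_insert]
    ring

theorem bernoulliSum_mono_prob {p' : ℝ} (hp0 : 0 ≤ p) (hpp : p ≤ p') (hp1 : p' ≤ 1)
    (s : Finset E) {f : Set E → ℝ} (hf : Monotone f) :
    bernoulliSum p s f ≤ bernoulliSum p' s f := by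
  classical
  induction s using Finset.induction_on generalizing f with
  | empty => simp [bernoulliSum]
  | insert a s ha ih =>
    rw [bernoulliSum_insert ha, bernoulliSum_insert ha]
    have h1 := ih hf
    have h2 := ih (f := fun H => f (insert a H)) fun H H' h => hf (Set.insert_subset_insert h)
    have h3 : bernoulliSum p' s f ≤ bernoulliSum p' s (fun H => f (insert a H)) :=
      bernoulliSum_mono (hp0.trans hpp) hp1 s fun H => hf (Set.subset_insert a H)
    nlinarith [mul_le_mul_of_nonneg_left h1 (by linarith : 0 ≤ 1 - p),
      mul_le_mul_of_nonneg_left h2 hp0, mul_nonneg (sub_nonneg.2 hpp) (sub_nonneg.2 h3)]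

theorem setBernoulli_real_eq_bernoulliSum [Fintype E] (p : unitInterval) (A : Set (Set E)) :
    (setBernoulli (Set.univ : Set E) p).real A =
      bernoulliSum (p : ℝ) Finset.univ (A.indicator 1) := by
  classical
  set A' : Finset (Finset E) := Finset.univ.filter fun H => (H : Set E) ∈ A with hA'
  have hA : A = ⋃ H ∈ A', {(H : Set E)} := by
    ext H
    simp only [hA', Finset.mem_filter, Finset.mem_univ, true_and, Set.mem_iUnion,
      Set.mem_singleton_iff, exists_prop]
    constructor
    · intro h
      exact ⟨Set.toFinset H, by rwa [Set.coe_toFinset], (Set.coe_toFinset H).symm⟩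
    · rintro ⟨K, hK, rfl⟩
      exact hK
  have key : (setBernoulli (Set.univ : Set E) p).real (⋃ H ∈ A', {(H : Set E)}) =
      ∑ H ∈ A', (setBernoulli (Set.univ : Set E) p).real {(H : Set E)} := by
    refine measureReal_biUnion_finset ?_ ?_
    · intro H _ H' _ hne
      simpa [Function.onFun] using hne
    · intro H _
      exact measurableSet_singleton _
  conv_lhs => rw [hA]
  rw [key]
  unfold bernoulliSum
  rw [Finset.powerset_univ, hA', Finset.sum_filter]
  refine Finset.sum_congr rfl fun H _ => ?_
  rw [setBernoulli_real_singleton p (Set.subset_univ _) Set.finite_univ]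
  have h1 : (Set.univ \ (H : Set E)).ncard = (Finset.univ : Finset E).card - H.card := by
    rw [← Set.compl_eq_univ_sdiff, ← Finset.coe_compl, Set.ncard_coe_finset, Finset.card_compl,
      Finset.card_univ]
  rw [h1, Set.ncard_coe_finset]
  by_cases h : (H : Set E) ∈ A <;> simp [h]

/-- Markov's inequality. -/
theorem bernoulliSum_indicator_le (hp0 : 0 ≤ p) (hp1 : p ≤ 1) (s : Finset E) {A : Set (Set E)}
    {f : Set E → ℝ} {a : ℝ} (hf : ∀ H, 0 ≤ f H) (ha : 0 ≤ a)
    (hA : ∀ H ∈ A, 1 ≤ a * f H) :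
    bernoulliSum p s (A.indicator 1) ≤ a * bernoulliSum p s f := by
  have : a * bernoulliSum p s f = bernoulliSum p s (fun H => a * f H) := by
    unfold bernoulliSum
    rw [Finset.mul_sum]
    exact Finset.sum_congr rfl fun _ _ => by ring
  rw [this]
  refine bernoulliSum_mono hp0 hp1 s fun H => ?_
  by_cases h : H ∈ A
  · simpa [h] using hA H h
  · simpa [h] using mul_nonneg ha (hf H)

end BernoulliSum

/-! ### Adaptive exploration of a random set -/

section Exploration

variable {E σ : Type*}

open Classical in
/-- One step of a process that inspects a set `H`: in the state `s` it asks whether the element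
`query s` (if there is one) belongs to `H`, and moves to the state `next s b`, where `b` is the
answer. If there is no query, it moves to `next s false`. -/
noncomputable def exploreStep (query : σ → Option E) (next : σ → Bool → σ) (H : Set E) (s : σ) :
    σ :=
  next s (match query s with
    | none => false
    | some e => decide (e ∈ H))

/-- The run of the process does not depend on the elements that were asked for before. -/
theorem iterate_exploreStep_congr {query : σ → Option E} {next : σ → Bool → σ}
    {asked : σ → Set E} (hquery : ∀ s e, query s = some e → e ∉ asked s)
    (hmono : ∀ s b, asked s ⊆ asked (next s b)) {H H' : Set E} (T : ℕ) (s : σ)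
    (hH : ∀ e ∉ asked s, e ∈ H ↔ e ∈ H') :
    (exploreStep query next H)^[T] s = (exploreStep query next H')^[T] s := by
  induction T generalizing s with
  | zero => rfl
  | succ T ih =>
    rw [Function.iterate_succ_apply, Function.iterate_succ_apply]
    have h1 : exploreStep query next H s = exploreStep query next H' s := by
      unfold exploreStep
      rcases hs : query s with _ | e
      · rfl
      · simp only
        rw [decide_eq_decide.2 (hH e (hquery s e hs))]
    rw [h1]
    exact ih _ fun e he => hH e fun h => he (hmono _ _ h)

/-- A function of the state that does not increase in conditional mean at any step has final mean at
most its initial value. No element is asked for twice, so every answer is independent of the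
past. -/
theorem bernoulliSum_iterate_exploreStep_le [Fintype E] {p : ℝ}
    {query : σ → Option E} {next : σ → Bool → σ}
    {asked : σ → Set E} (hquery : ∀ s e, query s = some e → e ∉ asked s)
    (hasked : ∀ s e b, query s = some e → e ∈ asked (next s b))
    (hmono : ∀ s b, asked s ⊆ asked (next s b)) {W : σ → ℝ} (hp0 : 0 ≤ p) (hp1 : p ≤ 1)
    (hW0 : ∀ s, query s = none → W (next s false) ≤ W s)
    (hW1 : ∀ s e, query s = some e → (1 - p) * W (next s false) + p * W (next s true) ≤ W s)
    (T : ℕ) (s : σ) :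
    bernoulliSum p Finset.univ (fun H => W ((exploreStep query next H)^[T] s)) ≤ W s := by
  classical
  induction T generalizing s with
  | zero => simp [bernoulliSum_const]
  | succ T ih =>
    simp only [Function.iterate_succ_apply]
    rcases hs : query s with _ | e
    · have : ∀ H, exploreStep query next H s = next s false := fun H => by
        simp [exploreStep, hs]
      simp only [this]
      exact (ih _).trans (hW0 s hs)
    · have h1 : ∀ H : Set E, exploreStep query next H s = next s (decide (e ∈ H)) := fun H => by
        simp [exploreStep, hs]
      simp only [h1]
      have hu : (Finset.univ : Finset E) = insert e (Finset.univ.erase e) := by simp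
      have hne : e ∉ (Finset.univ : Finset E).erase e := by simp
      -- the runs after the first step do not depend on whether `e ∈ H`
      have h2 : ∀ b, bernoulliSum p ((Finset.univ : Finset E).erase e)
          (fun H => W ((exploreStep query next (insert e H))^[T] (next s b))) =
          bernoulliSum p Finset.univ
            (fun H => W ((exploreStep query next H)^[T] (next s b))) := by
        intro b
        have h3 : ∀ H : Set E, (exploreStep query next (insert e H))^[T] (next s b) =
            (exploreStep query next H)^[T] (next s b) := fun H =>
          iterate_exploreStep_congr hquery hmono T _ fun x hx => by
            have : x ≠ e := by
              rintro rfl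
              exact hx (hasked s x b hs)
            simp [this]
        conv_rhs => rw [hu, bernoulliSum_insert hne]
        simp only [h3]
        ring
      have h4 : bernoulliSum p ((Finset.univ : Finset E).erase e)
          (fun H => W ((exploreStep query next H)^[T] (next s (decide (e ∈ H))))) =
          bernoulliSum p ((Finset.univ : Finset E).erase e)
          (fun H => W ((exploreStep query next (insert e H))^[T] (next s false))) := by
        unfold bernoulliSum
        refine Finset.sum_congr rfl fun H hH => ?_
        have : e ∉ H := fun h => hne (Finset.mem_powerset.1 hH h)
        have h5 : (exploreStep query next (insert e (H : Set E)))^[T] (next s false) =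
            (exploreStep query next H)^[T] (next s false) :=
          iterate_exploreStep_congr hquery hmono T _ fun x hx => by
            have : x ≠ e := by
              rintro rfl
              exact hx (hasked s x false hs)
            simp [this]
        simp [this, h5]
      rw [hu, bernoulliSum_insert hne, h4]
      simp only [Set.mem_insert_iff, true_or, decide_true]
      rw [h2, h2]
      calc _ ≤ (1 - p) * W (next s false) + p * W (next s true) := by
            have : 0 ≤ 1 - p := by linarith
            gcongr <;> exact ih _
        _ ≤ W s := hW1 s e hs

end Exploration

/-! ### The search process -/

/-- A query of the search: a `k`-set `x.1`, together with an already discovered vertex set `x.2`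
contained in it, its parent. -/
abbrev SearchQuery (V : Type*) (k : ℕ) : Type _ := {e : Finset V // e.card = k} × Finset V

/-- The state of a search for `j`-tuple-connected components: the queries made so far, those of
them that found an edge, the `j`-sets discovered so far, those discovered since the last time a
new seed was taken, and the seeds. -/
structure SearchState (V : Type*) (k : ℕ) where
  queried : Finset (SearchQuery V k)
  found : Finset (SearchQuery V k)
  discovered : Finset (Finset V)
  current : Finset (Finset V)
  seeds : Finset (Finset V)
  found_subset : found ⊆ queried

namespace SearchState

variable {V : Type*} {k : ℕ} [DecidableEq V]

/-- The search before its first step. -/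
def init : SearchState V k := ⟨∅, ∅, ∅, ∅, ∅, Finset.Subset.refl _⟩

/-- The state after the query `x` has found an edge: all `j`-sets inside it are discovered. -/
def hit (j : ℕ) (s : SearchState V k) (x : SearchQuery V k) : SearchState V k where
  queried := insert x s.queried
  found := insert x s.found
  discovered := s.discovered ∪ Finset.powersetCard j x.1
  current := s.current ∪ Finset.powersetCard j x.1
  seeds := s.seeds
  found_subset := Finset.insert_subset_insert _ s.found_subset

/-- The state after the query `x` has found no edge. -/
def miss (s : SearchState V k) (x : SearchQuery V k) : SearchState V k :=
  { s with
    queried := insert x s.queried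
    found_subset := s.found_subset.trans (Finset.subset_insert _ _) }

/-- The state after the `j`-set `J` has been taken as a new seed. -/
def addSeed (s : SearchState V k) (J : Finset V) : SearchState V k where
  queried := s.queried
  found := s.found
  discovered := insert J s.discovered
  current := {J}
  seeds := insert J s.seeds
  found_subset := s.found_subset

end SearchState

/-- The rules of a search: which queries are allowed, when to stop, when to stop rather than take a
new seed if no query is available, and the pool from which seeds are taken. -/
structure SearchRule (V : Type*) (k : ℕ) where
  j : ℕ
  allowed : SearchState V k → SearchQuery V k → Prop
  finished : SearchState V k → Prop
  idleStop : SearchState V k → Prop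
  pool : Finset (Finset V)

namespace SearchRule

variable {V : Type*} {k : ℕ}

/-- A query can be made if its `k`-set has not been queried, its parent is discovered and lies in
the `k`-set, and the rules allow it. -/
def Eligible (R : SearchRule V k) (s : SearchState V k) (x : SearchQuery V k) : Prop :=
  (∀ y ∈ s.queried, y.1 ≠ x.1) ∧ x.2 ∈ s.discovered ∧ x.2 ⊆ x.1 ∧ R.allowed s x

/-- The search has come to its end in the state `s`. -/
def Halted (R : SearchRule V k) (s : SearchState V k) : Prop :=
  R.finished s ∨ (∀ x, ¬ R.Eligible s x) ∧ (R.idleStop s ∨ R.pool ⊆ s.discovered)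

open Classical in
/-- The query made in the state `s`, if any. -/
noncomputable def nextQuery (R : SearchRule V k) (s : SearchState V k) :
    Option (SearchQuery V k) :=
  if R.finished s then none else if h : ∃ x, R.Eligible s x then some h.choose else none

variable {R : SearchRule V k} {s : SearchState V k}

theorem nextQuery_eq_some {x : SearchQuery V k} (h : R.nextQuery s = some x) :
    ¬ R.finished s ∧ R.Eligible s x := by
  unfold nextQuery at h
  split_ifs at h with h1 h2
  simp only [Option.some.injEq] at h
  exact ⟨h1, h ▸ h2.choose_spec⟩

theorem nextQuery_eq_none (h : R.nextQuery s = none) :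
    R.finished s ∨ ∀ x, ¬ R.Eligible s x := by
  unfold nextQuery at h
  split_ifs at h with h1 h2
  · exact Or.inl h1
  · exact Or.inr (not_exists.1 h2)

variable [DecidableEq V]

open Classical in
/-- The state after `s`, given the answer to the query made in `s`. -/
noncomputable def nextState (R : SearchRule V k) (s : SearchState V k) (b : Bool) :
    SearchState V k :=
  match R.nextQuery s with
  | some x => if b then s.hit R.j x else s.miss x
  | none =>
    if R.finished s ∨ R.idleStop s then s
    else if h : ∃ J, J ∈ R.pool ∧ J ∉ s.discovered then s.addSeed h.choose else s

/-- The state of the search of the hypergraph `H` after `T` steps. -/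
noncomputable def run (R : SearchRule V k) (H : UniformHypergraph V k) (T : ℕ) :
    SearchState V k :=
  (exploreStep (fun s => (R.nextQuery s).map Prod.fst) R.nextState H)^[T] SearchState.init

variable {H : UniformHypergraph V k}

/-- The cases in one step of a search from `s` to `s'`. -/
inductive Step (R : SearchRule V k) (H : UniformHypergraph V k) (s : SearchState V k) :
    SearchState V k → Prop
  | hit (x : SearchQuery V k) (h1 : ¬ R.finished s) (h2 : R.Eligible s x) (h3 : x.1 ∈ H) :
    Step R H s (s.hit R.j x)
  | miss (x : SearchQuery V k) (h1 : ¬ R.finished s) (h2 : R.Eligible s x) (h3 : x.1 ∉ H) :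
    Step R H s (s.miss x)
  | addSeed (J : Finset V) (h1 : ¬ R.finished s) (h2 : ∀ x, ¬ R.Eligible s x) (h3 : ¬ R.idleStop s)
    (h4 : J ∈ R.pool) (h5 : J ∉ s.discovered) : Step R H s (s.addSeed J)
  | halted (h : R.Halted s) : Step R H s s

theorem step_exploreStep (R : SearchRule V k) (H : UniformHypergraph V k)
    (s : SearchState V k) :
    R.Step H s (exploreStep (fun s => (R.nextQuery s).map Prod.fst) R.nextState H s) := by
  classical
  unfold exploreStep
  rcases hs : R.nextQuery s with _ | x
  · simp only [nextState, hs]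
    have h := nextQuery_eq_none hs
    split_ifs with h1 h2
    · refine Step.halted ?_
      rcases h1 with h1 | h1
      · exact Or.inl h1
      · exact h.imp id fun h => ⟨h, Or.inl h1⟩
    · rw [not_or] at h1
      exact Step.addSeed _ h1.1 (h.resolve_left h1.1) h1.2 h2.choose_spec.1 h2.choose_spec.2
    · refine Step.halted (h.imp id fun h => ⟨h, Or.inr fun J hJ => ?_⟩)
      by_contra hJ'
      exact h2 ⟨J, hJ, hJ'⟩
  · simp only [Option.map_some, nextState, hs]
    obtain ⟨h1, h2⟩ := nextQuery_eq_some hs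
    by_cases h3 : x.1 ∈ H
    · simpa [h3] using Step.hit x h1 h2 h3
    · simpa [h3] using Step.miss x h1 h2 h3

theorem run_zero : R.run H 0 = SearchState.init := rfl

theorem step_run (T : ℕ) : R.Step H (R.run H T) (R.run H (T + 1)) := by
  unfold run
  rw [Function.iterate_succ_apply']
  exact step_exploreStep R H _

/-- The facts about a state of the search that hold whatever the rules are. -/
structure Consistent (R : SearchRule V k) (H : UniformHypergraph V k)
    (s : SearchState V k) : Prop where
  eq_of_fst_eq : ∀ x ∈ s.queried, ∀ y ∈ s.queried, x.1 = y.1 → x = y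
  mem_found : ∀ x, x ∈ s.found ↔ x ∈ s.queried ∧ x.1 ∈ H
  parent_mem : ∀ x ∈ s.queried, x.2 ∈ s.discovered ∧ x.2 ⊆ x.1
  subset_discovered : ∀ x ∈ s.found, Finset.powersetCard R.j (x.1 : Finset V) ⊆ s.discovered
  seeds_subset_pool : s.seeds ⊆ R.pool
  seeds_subset_discovered : s.seeds ⊆ s.discovered
  card_eq : ∀ J ∈ s.discovered, J.card = R.j

theorem consistent_run (hpool : ∀ J ∈ R.pool, J.card = R.j) (T : ℕ) :
    R.Consistent H (R.run H T) := by
  induction T with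
  | zero => constructor <;> simp [run_zero, SearchState.init]
  | succ T ih =>
    have hstep := step_run (R := R) (H := H) T
    generalize R.run H T = s at ih hstep
    generalize R.run H (T + 1) = s' at hstep
    obtain ⟨i1, i2, i3, i4, i5, i6, i7⟩ := ih
    cases hstep with
    | hit x h1 h2 h3 =>
      obtain ⟨e1, e2, e3, -⟩ := h2
      constructor
      · simp only [SearchState.hit, Finset.mem_insert]
        grind
      · simp only [SearchState.hit, Finset.mem_insert]
        grind
      · simp only [SearchState.hit, Finset.mem_insert, Finset.mem_union]
        grind
      · simp only [SearchState.hit, Finset.mem_insert]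
        rintro y (rfl | hy)
        · exact Finset.subset_union_right
        · exact (i4 y hy).trans Finset.subset_union_left
      · exact i5
      · exact i6.trans Finset.subset_union_left
      · simp only [SearchState.hit, Finset.mem_union, Finset.mem_powersetCard]
        grind
    | miss x h1 h2 h3 =>
      obtain ⟨e1, e2, e3, -⟩ := h2
      constructor
      · simp only [SearchState.miss, Finset.mem_insert]
        grind
      · simp only [SearchState.miss, Finset.mem_insert]
        grind
      · simp only [SearchState.miss, Finset.mem_insert]
        grind
      · exact i4
      · exact i5
      · exact i6
      · exact i7
    | addSeed J h1 h2 h3 h4 h5 =>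
      constructor
      · exact i1
      · exact i2
      · exact fun x hx => ⟨Finset.mem_insert_of_mem (i3 x hx).1, (i3 x hx).2⟩
      · exact fun x hx => (i4 x hx).trans (Finset.subset_insert _ _)
      · exact Finset.insert_subset h4 i5
      · exact Finset.insert_subset_insert _ i6
      · simp only [SearchState.addSeed, Finset.mem_insert]
        grind
    | halted h => exact ⟨i1, i2, i3, i4, i5, i6, i7⟩

/-- The search has halted after as many steps as there are `k`-sets and seeds in the pool. -/
theorem halted_run [Fintype V] (hpool : ∀ J ∈ R.pool, J.card = R.j) {T : ℕ}
    (hT : Fintype.card {e : Finset V // e.card = k} + R.pool.card < T) :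
    R.Halted (R.run H T) := by
  have key : ∀ T, R.Halted (R.run H T) ∨
      T ≤ (R.run H T).queried.card + (R.run H T).seeds.card := by
    intro T
    induction T with
    | zero => exact Or.inr (Nat.zero_le _)
    | succ T ih =>
      have hstep := step_run (R := R) (H := H) T
      have hc := consistent_run (H := H) hpool T
      generalize R.run H T = s at ih hstep hc
      generalize R.run H (T + 1) = s' at hstep
      cases hstep with
      | hit x h1 h2 h3 =>
        have hx : x ∉ s.queried := fun hx => h2.1 x hx rfl
        rcases ih with ih | ih
        · exact absurd h2 (ih.resolve_left h1 |>.1 x)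
        · right
          simp only [SearchState.hit, Finset.card_insert_of_notMem hx]
          omega
      | miss x h1 h2 h3 =>
        have hx : x ∉ s.queried := fun hx => h2.1 x hx rfl
        rcases ih with ih | ih
        · exact absurd h2 (ih.resolve_left h1 |>.1 x)
        · right
          simp only [SearchState.miss, Finset.card_insert_of_notMem hx]
          omega
      | addSeed J h1 h2 h3 h4 h5 =>
        have hJ : J ∉ s.seeds := fun h => h5 (hc.seeds_subset_discovered h)
        rcases ih with ih | ih
        · rcases (ih.resolve_left h1).2 with h | h
          · exact absurd h h3
          · exact absurd (h h4) h5
        · right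
          simp only [SearchState.addSeed, Finset.card_insert_of_notMem hJ]
          omega
      | halted h => exact Or.inl h
  refine (key T).resolve_right fun h => ?_
  have hc := consistent_run (H := H) hpool T
  have h1 : (R.run H T).queried.card ≤ Fintype.card {e : Finset V // e.card = k} := by
    rw [← Finset.card_univ]
    exact Finset.card_le_card_of_injOn Prod.fst (fun _ _ => Finset.mem_coe.2 (Finset.mem_univ _))
      fun x hx y hy hxy => hc.eq_of_fst_eq x hx y hy hxy
  have h2 := Finset.card_le_card hc.seeds_subset_pool
  omega

/-! ### Degrees of vertex sets in the discovered family -/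

end SearchRule

/-- The number of members of the family `A` that contain `L`. -/
def upDegree {V : Type*} [DecidableEq V] (A : Finset (Finset V)) (L : Finset V) : ℕ :=
  (A.filter fun J => L ⊆ J).card

/-- The number of `j`-sets containing `L`, other than the parent, inside the `k`-set of a query. -/
def SearchQuery.gain {V : Type*} [DecidableEq V] {k : ℕ} (j : ℕ) (L : Finset V)
    (x : SearchQuery V k) : ℕ :=
  ((Finset.powersetCard j (x.1 : Finset V)).filter fun J => L ⊆ J ∧ J ≠ x.2).card

namespace SearchRule

variable {V : Type*} {k : ℕ} [DecidableEq V]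
variable {R : SearchRule V k} {H : UniformHypergraph V k} {s : SearchState V k}

theorem upDegree_hit_le (L : Finset V) {x : SearchQuery V k} (hx : x.2 ∈ s.discovered) :
    upDegree (s.hit R.j x).discovered L ≤ upDegree s.discovered L + x.gain R.j L := by
  unfold upDegree SearchQuery.gain
  refine (Finset.card_le_card ?_).trans (Finset.card_union_le _ _)
  intro J
  simp only [SearchState.hit, Finset.mem_filter, Finset.mem_union]
  grind

theorem upDegree_mono {A B : Finset (Finset V)} (h : A ⊆ B) (L : Finset V) :
    upDegree A L ≤ upDegree B L :=
  Finset.card_le_card (Finset.filter_subset_filter _ h)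

theorem upDegree_empty (A : Finset (Finset V)) : upDegree A ∅ = A.card := by
  simp [upDegree]

theorem gain_le (j : ℕ) (L : Finset V) (x : SearchQuery V k) : x.gain j L ≤ 2 ^ k := by
  unfold SearchQuery.gain
  refine (Finset.card_filter_le _ _).trans ?_
  rw [Finset.card_powersetCard, x.1.2]
  exact Nat.choose_le_two_pow k j

theorem upDegree_insert {A : Finset (Finset V)} {J : Finset V} (hJ : J ∉ A) (L : Finset V) :
    upDegree (insert J A) L = upDegree A L + if L ⊆ J then 1 else 0 := by
  unfold upDegree
  rw [Finset.filter_insert]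
  split_ifs
  · exact Finset.card_insert_of_notMem fun h => hJ (Finset.mem_filter.1 h).1
  · rfl

/-- Every discovered `j`-set is a seed or was gained when an edge was found. -/
theorem upDegree_run_le (hpool : ∀ J ∈ R.pool, J.card = R.j) (L : Finset V) (T : ℕ) :
    upDegree (R.run H T).discovered L ≤
      upDegree (R.run H T).seeds L + ∑ x ∈ (R.run H T).found, x.gain R.j L := by
  induction T with
  | zero => simp [run_zero, SearchState.init, upDegree]
  | succ T ih =>
    have hstep := step_run (R := R) (H := H) T
    have hc := consistent_run (H := H) hpool T
    generalize R.run H T = s at ih hstep hc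
    generalize R.run H (T + 1) = s' at hstep
    cases hstep with
    | hit x h1 h2 h3 =>
      have hx : x ∉ s.found := fun hx => h2.1 x ((hc.mem_found x).1 hx).1 rfl
      have := upDegree_hit_le (R := R) L h2.2.1
      simp only [SearchState.hit, Finset.sum_insert hx] at this ⊢
      omega
    | miss x h1 h2 h3 => exact ih
    | addSeed J h1 h2 h3 h4 h5 =>
      simp only [SearchState.addSeed]
      rw [upDegree_insert h5, upDegree_insert fun h => h5 (hc.seeds_subset_discovered h)]
      omega
    | halted h => exact ih

/-- A degree that makes the search stop once it reaches `B` exceeds `B` by at most `2 ^ k`, the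
largest change in a single step. -/
theorem upDegree_run_lt {L : Finset V} {B : ℝ} (hB : 0 < B)
    (hfin : ∀ s, B ≤ upDegree s.discovered L → R.finished s) (T : ℕ) :
    (upDegree (R.run H T).discovered L : ℝ) < B + 2 ^ k := by
  induction T with
  | zero =>
    have : (0 : ℝ) < B + 2 ^ k := by positivity
    simpa [run_zero, SearchState.init, upDegree] using this
  | succ T ih =>
    have hstep := step_run (R := R) (H := H) T
    generalize R.run H T = s at ih hstep
    generalize R.run H (T + 1) = s' at hstep
    have hlt : ¬ R.finished s → (upDegree s.discovered L : ℝ) < B := fun h => by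
      by_contra h'
      exact h (hfin s (not_lt.1 h'))
    cases hstep with
    | hit x h1 h2 h3 =>
      have h4 := (upDegree_hit_le (R := R) L h2.2.1).trans
        (Nat.add_le_add_left (gain_le R.j L x) _)
      have h5 : (upDegree (s.hit R.j x).discovered L : ℝ) ≤ upDegree s.discovered L + 2 ^ k := by
        exact_mod_cast h4
      linarith [hlt h1]
    | miss x h1 h2 h3 => exact ih
    | addSeed J h1 h2 h3 h4 h5 =>
      have h6 : (upDegree (s.addSeed J).discovered L : ℝ) ≤ upDegree s.discovered L + 1 := by
        have : upDegree (s.addSeed J).discovered L ≤ upDegree s.discovered L + 1 := by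
          simp only [SearchState.addSeed]
          rw [upDegree_insert h5]
          split_ifs <;> omega
        exact_mod_cast this
      have h7 : (1 : ℝ) ≤ 2 ^ k := one_le_pow₀ one_le_two
      linarith [hlt h1]
    | halted h => exact ih

end SearchRule

/-! ### The exponential supermartingale of a search -/

namespace SearchRule

variable {V : Type*} {k : ℕ} [DecidableEq V]

/-- For every weight `g` on queries, the exponential of
`∑_{found} g - p ∑_{queried} (exp g - 1)` is a supermartingale along the search; Markov's inequality
bounds its upper tail. -/
theorem measureReal_potential_le [Fintype V] (R : SearchRule V k) (p : unitInterval)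
    (g : SearchQuery V k → ℝ) (T : ℕ) (a : ℝ) :
    (setBernoulli (Set.univ : Set {e : Finset V // e.card = k}) p).real
      {H | a ≤ ∑ x ∈ (R.run H T).found, g x -
        p * ∑ x ∈ (R.run H T).queried, (Real.exp (g x) - 1)} ≤ Real.exp (-a) := by
  classical
  obtain ⟨p, hp0, hp1⟩ := p
  rw [setBernoulli_real_eq_bernoulliSum]
  simp only
  set W : SearchState V k → ℝ := fun s =>
    Real.exp (∑ x ∈ s.found, g x - p * ∑ x ∈ s.queried, (Real.exp (g x) - 1)) with hWdef
  have hW : bernoulliSum p Finset.univ (fun H => W (R.run H T)) ≤ W SearchState.init := by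
    refine bernoulliSum_iterate_exploreStep_le
      (asked := fun s => {e | ∃ y ∈ s.queried, y.1 = e}) ?_ ?_ ?_ hp0 hp1 ?_ ?_ T _
    · rintro s e he ⟨y, hy, rfl⟩
      obtain ⟨x, hx, hxy⟩ := Option.map_eq_some_iff.1 he
      exact (nextQuery_eq_some hx).2.1 y hy hxy.symm
    · intro s e b he
      obtain ⟨x, hx, rfl⟩ := Option.map_eq_some_iff.1 he
      refine ⟨x, ?_, rfl⟩
      cases b <;> simp [nextState, hx, SearchState.hit, SearchState.miss]
    · rintro s b e ⟨y, hy, rfl⟩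
      refine ⟨y, ?_, rfl⟩
      rcases hs : R.nextQuery s with _ | x
      · simp only [nextState, hs]
        split_ifs <;> simpa [SearchState.addSeed] using hy
      · cases b <;> simp [nextState, hs, SearchState.hit, SearchState.miss, hy]
    · intro s hs
      rw [Option.map_eq_none_iff] at hs
      have : (R.nextState s false).queried = s.queried ∧
          (R.nextState s false).found = s.found := by
        simp only [nextState, hs]
        split_ifs <;> exact ⟨rfl, rfl⟩
      simp only [hWdef, this.1, this.2]
      exact le_rfl
    · intro s e he
      obtain ⟨x, hx, rfl⟩ := Option.map_eq_some_iff.1 he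
      have hxq : x ∉ s.queried := fun h => (nextQuery_eq_some hx).2.1 x h rfl
      have hxf : x ∉ s.found := fun h => hxq (s.found_subset h)
      set A := ∑ x ∈ s.found, g x with hA
      set B := ∑ x ∈ s.queried, (Real.exp (g x) - 1) with hB
      have h1 : W (R.nextState s true) = W s *
          (Real.exp (g x) * Real.exp (-(p * (Real.exp (g x) - 1)))) := by
        simp only [hWdef, nextState, hx, SearchState.hit, if_true, Finset.sum_insert hxq,
          Finset.sum_insert hxf, ← Real.exp_add]
        congr 1
        ring
      have h2 : W (R.nextState s false) = W s * Real.exp (-(p * (Real.exp (g x) - 1))) := by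
        simp only [hWdef, nextState, hx, SearchState.miss, Bool.false_eq_true, if_false,
          Finset.sum_insert hxq, ← Real.exp_add]
        congr 1
        ring
      rw [h1, h2]
      set y := p * (Real.exp (g x) - 1) with hy
      have h3 : 1 + y ≤ Real.exp y := by linarith [Real.add_one_le_exp y]
      have h4 : (1 + y) * Real.exp (-y) ≤ 1 := by
        calc (1 + y) * Real.exp (-y) ≤ Real.exp y * Real.exp (-y) := by gcongr
          _ = 1 := by rw [← Real.exp_add]; simp
      calc _ = W s * ((1 + y) * Real.exp (-y)) := by rw [hy]; ring
        _ ≤ W s * 1 := by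
            have : 0 ≤ W s := (Real.exp_pos _).le
            gcongr
        _ = W s := mul_one _
  have hW1 : W SearchState.init = 1 := by simp [hWdef, SearchState.init]
  rw [hW1] at hW
  calc _ ≤ Real.exp (-a) * bernoulliSum p Finset.univ (fun H => W (R.run H T)) := by
        refine bernoulliSum_indicator_le hp0 hp1 _ (fun H => (Real.exp_pos _).le)
          (Real.exp_pos _).le fun H hH => ?_
        simp only [hWdef, ← Real.exp_add]
        rw [Real.one_le_exp_iff]
        simp only [Set.mem_ofPred_eq] at hH
        linarith
    _ ≤ Real.exp (-a) * 1 := by gcongr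
    _ = _ := mul_one _

end SearchRule

/-! ### Counting `k`-sets -/

section Counting

variable {V : Type*} [Fintype V] [DecidableEq V]

/-- The `k`-sets that contain `A`. -/
def edgesAbove (k : ℕ) (A : Finset V) : Finset {e : Finset V // e.card = k} :=
  Finset.univ.filter fun e : {e : Finset V // e.card = k} => A ⊆ (e : Finset V)

theorem mem_edgesAbove {k : ℕ} {A : Finset V} {e : {e : Finset V // e.card = k}} :
    e ∈ edgesAbove k A ↔ A ⊆ (e : Finset V) := by
  simp [edgesAbove]

theorem card_edgesAbove {k : ℕ} {A : Finset V} (hA : A.card ≤ k) :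
    (edgesAbove k A).card = (Fintype.card V - A.card).choose (k - A.card) := by
  rw [← Finset.card_univ,
    ← Finset.card_filter_powersetCard_subset _ _ _ (Finset.subset_univ _) hA]
  refine Finset.card_bij (fun e _ => (e : Finset V)) ?_ ?_ ?_
  · intro e he
    simpa [e.2] using mem_edgesAbove.1 he
  · intro e _ e' _ h
    exact Subtype.ext h
  · intro e he
    simp only [Finset.mem_filter, Finset.mem_powersetCard, Finset.subset_univ, true_and] at he
    exact ⟨⟨e, he.1⟩, mem_edgesAbove.2 he.2, rfl⟩

theorem choose_mul_factorial_le (n j k : ℕ) :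
    ((n - j).choose (k - j) : ℝ) * ((k - j).factorial : ℝ) ≤ (n : ℝ) ^ (k - j) := by
  have h : (n - j).choose (k - j) * (k - j).factorial ≤ n ^ (k - j) := by
    rw [mul_comm, ← Nat.descFactorial_eq_factorial_mul_choose]
    exact (Nat.descFactorial_le_pow _ _).trans (Nat.pow_le_pow_left (Nat.sub_le _ _) _)
  exact_mod_cast h

theorem le_choose_mul_factorial {n j k : ℕ} (hjk : j ≤ k) (hkn : k ≤ n) (hn : 0 < n) :
    (n : ℝ) ^ (k - j) * (1 - k ^ 2 / n) ≤
      ((n - j).choose (k - j) : ℝ) * ((k - j).factorial : ℝ) := by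
  have hn' : (0 : ℝ) < n := by exact_mod_cast hn
  have h : (n - k) ^ (k - j) ≤ (n - j).choose (k - j) * (k - j).factorial := by
    rw [mul_comm, ← Nat.descFactorial_eq_factorial_mul_choose]
    refine le_trans ?_ (Nat.pow_sub_le_descFactorial _ _)
    exact Nat.pow_le_pow_left (by omega) _
  have h1 : ((n : ℝ) - k) ^ (k - j) ≤
      ((n - j).choose (k - j) : ℝ) * ((k - j).factorial : ℝ) := by
    rw [← Nat.cast_sub hkn]
    exact_mod_cast h
  refine le_trans ?_ h1
  have h2 : (n : ℝ) - k = n * (1 + -(k / n)) := by field_simp; ring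
  rw [h2, mul_pow]
  have h3 : (k : ℝ) / n ≤ 1 := by
    rw [div_le_one hn']
    exact_mod_cast hkn
  have h4 := one_add_mul_le_pow (a := -((k : ℝ) / n)) (by linarith) (k - j)
  refine mul_le_mul_of_nonneg_left (le_trans ?_ h4) (by positivity)
  have h5 : ((k - j : ℕ) : ℝ) ≤ k := by exact_mod_cast Nat.sub_le k j
  have h6 : ((k - j : ℕ) : ℝ) * (k / n) ≤ k * (k / n) := by gcongr
  have h7 : (k : ℝ) ^ 2 / n = k * (k / n) := by ring
  rw [h7]
  linarith

theorem card_edgesAbove_le (k : ℕ) (A : Finset V) (hV : 0 < Fintype.card V) :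
    ((edgesAbove k A).card : ℝ) ≤ (Fintype.card V : ℝ) ^ k / (Fintype.card V : ℝ) ^ A.card := by
  have hV' : (0 : ℝ) < Fintype.card V := by exact_mod_cast hV
  by_cases hA : A.card ≤ k
  · rw [card_edgesAbove hA, div_eq_mul_inv, ← pow_sub₀ _ hV'.ne' hA]
    refine le_trans ?_ (choose_mul_factorial_le _ A.card k)
    have : (1 : ℝ) ≤ ((k - A.card).factorial : ℝ) := by exact_mod_cast Nat.factorial_pos _
    exact le_mul_of_one_le_right (by positivity) this
  · have : edgesAbove k A = ∅ := by
      refine Finset.eq_empty_of_forall_notMem fun e he => hA ?_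
      have := Finset.card_le_card (mem_edgesAbove.1 he)
      rwa [e.2] at this
    rw [this]
    simp only [Finset.card_empty, Nat.cast_zero]
    positivity

/-- The number of `k`-sets that contain both `A` and a member of `D` not above `A`, when the numbers
of members of `D` above the proper subsets of `A` are bounded. Members `J` of `D` are sorted by
their intersection with `A`. -/
theorem sum_card_edgesAbove_union_le (k : ℕ) {j : ℕ} {D : Finset (Finset V)}
    (hD : ∀ J ∈ D, J.card = j) (A : Finset V) (hV : 0 < Fintype.card V) {b : ℝ}
    (hb0 : 0 ≤ b) (hb : ∀ L, L ⊂ A → (upDegree D L : ℝ) * (Fintype.card V : ℝ) ^ L.card ≤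
      b * (Fintype.card V : ℝ) ^ j) :
    ∑ J ∈ D.filter (fun J => ¬ A ⊆ J), ((edgesAbove k (J ∪ A)).card : ℝ) ≤
      2 ^ A.card * (b * ((Fintype.card V : ℝ) ^ k / (Fintype.card V : ℝ) ^ A.card)) := by
  set n : ℝ := (Fintype.card V : ℝ) with hn
  have hn0 : 0 < n := by rw [hn]; exact_mod_cast hV
  have hmaps : ∀ J ∈ D.filter (fun J => ¬ A ⊆ J), J ∩ A ∈ A.ssubsets := by
    intro J hJ
    rw [Finset.mem_ssubsets, Finset.ssubset_iff_subset_ne]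
    refine ⟨Finset.inter_subset_right, fun h => (Finset.mem_filter.1 hJ).2 ?_⟩
    rw [← h]
    exact Finset.inter_subset_left
  rw [← Finset.sum_fiberwise_of_maps_to hmaps]
  have hterm : ∀ L ∈ A.ssubsets, ∑ J ∈ (D.filter (fun J => ¬ A ⊆ J)).filter (fun J => J ∩ A = L),
      ((edgesAbove k (J ∪ A)).card : ℝ) ≤ b * (n ^ k / n ^ A.card) := by
    intro L hL
    rw [Finset.mem_ssubsets] at hL
    have h1 : ∀ J ∈ (D.filter (fun J => ¬ A ⊆ J)).filter (fun J => J ∩ A = L),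
        ((edgesAbove k (J ∪ A)).card : ℝ) ≤ n ^ L.card * (n ^ k / (n ^ j * n ^ A.card)) := by
      intro J hJ
      simp only [Finset.mem_filter] at hJ
      have h2 := Finset.card_union_add_card_inter J A
      rw [hD J hJ.1.1, hJ.2] at h2
      refine (card_edgesAbove_le k (J ∪ A) hV).trans_eq ?_
      rw [← hn, ← pow_add n j, ← h2, pow_add]
      field_simp
    have h3 : ((D.filter (fun J => ¬ A ⊆ J)).filter (fun J => J ∩ A = L)).card ≤ upDegree D L := by
      refine Finset.card_le_card fun J hJ => ?_
      simp only [Finset.mem_filter] at hJ ⊢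
      exact ⟨hJ.1.1, by rw [← hJ.2]; exact Finset.inter_subset_left⟩
    calc _ ≤ ∑ _J ∈ (D.filter (fun J => ¬ A ⊆ J)).filter (fun J => J ∩ A = L),
          n ^ L.card * (n ^ k / (n ^ j * n ^ A.card)) := Finset.sum_le_sum h1
      _ = ((D.filter (fun J => ¬ A ⊆ J)).filter (fun J => J ∩ A = L)).card *
          (n ^ L.card * (n ^ k / (n ^ j * n ^ A.card))) := by
        rw [Finset.sum_const, nsmul_eq_mul]
      _ ≤ upDegree D L * (n ^ L.card * (n ^ k / (n ^ j * n ^ A.card))) := by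
        gcongr
      _ = (upDegree D L * n ^ L.card) * (n ^ k / (n ^ j * n ^ A.card)) := by ring
      _ ≤ (b * n ^ j) * (n ^ k / (n ^ j * n ^ A.card)) := by
        exact mul_le_mul_of_nonneg_right (hb L hL) (by positivity)
      _ = b * (n ^ k / n ^ A.card) := by field_simp
  refine (Finset.sum_le_sum hterm).trans ?_
  rw [Finset.sum_const, nsmul_eq_mul]
  have h6 : (A.ssubsets.card : ℝ) ≤ 2 ^ A.card := by
    have : A.ssubsets.card ≤ 2 ^ A.card := by
      rw [← Finset.card_powerset]
      exact Finset.card_le_card (Finset.erase_subset _ _)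
    exact_mod_cast this
  gcongr

end Counting

/-! ### Counting queries -/

namespace SearchRule

variable {V : Type*} {k : ℕ} [Fintype V] [DecidableEq V]
variable {R : SearchRule V k} {H : UniformHypergraph V k} {s : SearchState V k}

/-- Queries are counted by their parents: the `k`-sets of the queries with parent `J` are distinct
and contain `f J`. -/
theorem card_queried_filter_le (hc : R.Consistent H s)
    (P : SearchQuery V k → Prop) [DecidablePred P] (Q : Finset V → Prop) [DecidablePred Q]
    (f : Finset V → Finset V)
    (hPQ : ∀ x ∈ s.queried, P x → Q x.2 ∧ f x.2 ⊆ x.1) :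
    (s.queried.filter P).card ≤ ∑ J ∈ s.discovered.filter Q, (edgesAbove k (f J)).card := by
  have hmaps : ∀ x ∈ s.queried.filter P, x.2 ∈ s.discovered.filter Q := by
    intro x hx
    rw [Finset.mem_filter] at hx ⊢
    exact ⟨(hc.parent_mem x hx.1).1, (hPQ x hx.1 hx.2).1⟩
  rw [Finset.card_eq_sum_card_fiberwise hmaps]
  refine Finset.sum_le_sum fun J hJ => ?_
  refine Finset.card_le_card_of_injOn Prod.fst ?_ ?_
  · intro x hx
    simp only [Finset.coe_filter, Finset.mem_filter, Set.mem_ofPred_eq] at hx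
    obtain ⟨⟨h1, h2⟩, rfl⟩ := hx
    exact Finset.mem_coe.2 (mem_edgesAbove.2 (hPQ x h1 h2).2)
  · intro x hx y hy hxy
    simp only [Finset.coe_filter, Finset.mem_filter, Set.mem_ofPred_eq] at hx hy
    exact hc.eq_of_fst_eq x hx.1.1 y hy.1.1 hxy

/-- Each discovered `j`-set is the parent of at most as many queries as there are `k`-sets
containing it. -/
theorem card_queried_parent_above_le (hjk : R.j ≤ k) (hc : R.Consistent H s) (L : Finset V) :
    (s.queried.filter fun x => L ⊆ x.2).card ≤
      upDegree s.discovered L * (Fintype.card V - R.j).choose (k - R.j) := by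
  refine (card_queried_filter_le hc _ (fun J => L ⊆ J) id
    fun x hx h => ⟨h, (hc.parent_mem x hx).2⟩).trans_eq ?_
  unfold upDegree
  rw [Finset.sum_const_nat]
  intro J hJ
  have h := hc.card_eq J (Finset.mem_filter.1 hJ).1
  rw [id, card_edgesAbove (by omega), h]

/-- The queries by which the search can enter the sets above `L`. -/
theorem card_queried_enter_le (hc : R.Consistent H s) (L : Finset V) (hV : 0 < Fintype.card V)
    {b : ℝ} (hb0 : 0 ≤ b) (hb : ∀ L', L' ⊂ L → (upDegree s.discovered L' : ℝ) *
      (Fintype.card V : ℝ) ^ L'.card ≤ b * (Fintype.card V : ℝ) ^ R.j) :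
    ((s.queried.filter fun x => L ⊆ x.1 ∧ ¬ L ⊆ x.2).card : ℝ) ≤
      2 ^ L.card * (b * ((Fintype.card V : ℝ) ^ k / (Fintype.card V : ℝ) ^ L.card)) := by
  refine le_trans ?_ (sum_card_edgesAbove_union_le k hc.card_eq L hV hb0 hb)
  have := card_queried_filter_le hc (fun x => L ⊆ x.1 ∧ ¬ L ⊆ x.2) (fun J => ¬ L ⊆ J)
    (fun J => J ∪ L) fun x hx h => ⟨h.2, Finset.union_subset (hc.parent_mem x hx).2 h.1⟩
  exact_mod_cast this

/-- The queries are at least as many as the `k`-sets with a single discovered `j`-set inside, if all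
of the latter have been queried. -/
theorem le_card_queried (hjk : R.j ≤ k) (hc : R.Consistent H s) (hV : 0 < Fintype.card V)
    (hsole : ∀ e : {e : Finset V // e.card = k}, ∀ J ∈ s.discovered, J ⊆ (e : Finset V) →
      (∀ J' ∈ s.discovered, J' ⊆ (e : Finset V) → J' = J) → ∃ y ∈ s.queried, y.1 = e)
    {b : ℝ} (hb0 : 0 ≤ b) (hb : ∀ J ∈ s.discovered, ∀ L, L ⊂ J → (upDegree s.discovered L : ℝ) *
      (Fintype.card V : ℝ) ^ L.card ≤ b * (Fintype.card V : ℝ) ^ R.j) :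
    (s.discovered.card : ℝ) * ((Fintype.card V - R.j).choose (k - R.j) -
      2 ^ R.j * (b * ((Fintype.card V : ℝ) ^ k / (Fintype.card V : ℝ) ^ R.j))) ≤
      s.queried.card := by
  classical
  set sole : Finset V → Finset {e : Finset V // e.card = k} := fun J =>
    (edgesAbove k J).filter fun e => ∀ J' ∈ s.discovered, J' ⊆ (e : Finset V) → J' = J with hsd
  have h1 : ∀ J ∈ s.discovered, ((Fintype.card V - R.j).choose (k - R.j) : ℝ) -
      2 ^ R.j * (b * ((Fintype.card V : ℝ) ^ k / (Fintype.card V : ℝ) ^ R.j)) ≤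
      (sole J).card := by
    intro J hJ
    have hJc := hc.card_eq J hJ
    have h2 := sum_card_edgesAbove_union_le k hc.card_eq J hV hb0 (hb J hJ)
    rw [hJc] at h2
    have h3 : edgesAbove k J ⊆ sole J ∪ (s.discovered.filter fun J' => ¬ J ⊆ J').biUnion
        fun J' => edgesAbove k (J' ∪ J) := by
      intro e he
      rw [Finset.mem_union]
      by_cases h : ∀ J' ∈ s.discovered, J' ⊆ (e : Finset V) → J' = J
      · exact Or.inl (Finset.mem_filter.2 ⟨he, h⟩)
      · push Not at h
        obtain ⟨J', h4, h5, h6⟩ := h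
        refine Or.inr (Finset.mem_biUnion.2 ⟨J', Finset.mem_filter.2 ⟨h4, fun h7 => h6 ?_⟩,
          mem_edgesAbove.2 (Finset.union_subset h5 (mem_edgesAbove.1 he))⟩)
        exact (Finset.eq_of_subset_of_card_le h7 (by rw [hJc, hc.card_eq J' h4])).symm
    have h4 : ((edgesAbove k J).card : ℝ) ≤ (sole J).card +
        ∑ J' ∈ s.discovered.filter fun J' => ¬ J ⊆ J', ((edgesAbove k (J' ∪ J)).card : ℝ) := by
      have := (Finset.card_le_card h3).trans ((Finset.card_union_le _ _).trans
        (Nat.add_le_add_left Finset.card_biUnion_le _))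
      exact_mod_cast this
    rw [card_edgesAbove (by omega), hJc] at h4
    linarith
  have h2 : (s.discovered.biUnion sole).card = ∑ J ∈ s.discovered, (sole J).card := by
    refine Finset.card_biUnion fun J hJ J' hJ' hne => Finset.disjoint_left.2 fun e he he' => ?_
    rw [hsd, Finset.mem_filter, mem_edgesAbove] at he he'
    exact hne (he'.2 J hJ he.1)
  have h3 : s.discovered.biUnion sole ⊆ s.queried.image Prod.fst := by
    intro e he
    obtain ⟨J, hJ, he⟩ := Finset.mem_biUnion.1 he
    rw [hsd, Finset.mem_filter, mem_edgesAbove] at he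
    exact Finset.mem_image.2 (hsole e J hJ he.1 he.2)
  have h4 : ∑ J ∈ s.discovered, (sole J).card ≤ s.queried.card := by
    rw [← h2]
    exact (Finset.card_le_card h3).trans Finset.card_image_le
  calc _ = ∑ _J ∈ s.discovered, (((Fintype.card V - R.j).choose (k - R.j) : ℝ) -
      2 ^ R.j * (b * ((Fintype.card V : ℝ) ^ k / (Fintype.card V : ℝ) ^ R.j))) := by
        rw [Finset.sum_const, nsmul_eq_mul]
    _ ≤ ∑ J ∈ s.discovered, ((sole J).card : ℝ) := Finset.sum_le_sum h1
    _ ≤ _ := by exact_mod_cast h4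

end SearchRule

/-! ### The threshold and asymptotic probabilities -/

theorem two_le_choose {k j : ℕ} (hj : 1 ≤ j) (hjk : j < k) : 2 ≤ k.choose j := by
  obtain ⟨k, rfl⟩ := Nat.exists_eq_add_of_le' (by omega : 1 ≤ k)
  obtain ⟨j, rfl⟩ := Nat.exists_eq_add_of_le' hj
  rw [Nat.choose_succ_succ']
  have h1 := Nat.choose_pos (by omega : j ≤ k)
  have h2 := Nat.choose_pos (by omega : j + 1 ≤ k)
  omega

theorem thresholdProb_eq {k j : ℕ} (hj : 1 ≤ j) (hjk : j < k) (n : ℕ) :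
    thresholdProb k j n =
      ((k - j).factorial : ℝ) / (((k.choose j - 1 : ℕ) : ℝ) * (n : ℝ) ^ (k - j)) := by
  have h2 := two_le_choose hj hjk
  unfold thresholdProb
  rw [show (j : ℤ) - (k : ℤ) = -((k - j : ℕ) : ℤ) by omega, zpow_neg, zpow_natCast,
    Nat.cast_sub (by omega)]
  push_cast
  rw [div_mul_eq_div_div, div_eq_mul_inv _ ((n : ℝ) ^ (k - j))]

theorem holdsAAS_of_eventually_le {k : ℕ} {p : ℕ → unitInterval}
    {A : (n : ℕ) → UniformHypergraph (Fin n) k → Prop} {b : ℕ → ℝ}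
    (hb : Tendsto b atTop (𝓝 0))
    (hA : ∀ᶠ n in atTop, (setBernoulli (Set.univ : Set {e : Finset (Fin n) // e.card = k})
      (p n)).real {H | ¬ A n H} ≤ b n) : HoldsAAS k p A := by
  unfold HoldsAAS randomHypergraph
  have h0 : Tendsto (fun n => 1 - ENNReal.ofReal (b n)) atTop (𝓝 1) := by
    have h1 : Tendsto (fun n => ENNReal.ofReal (b n)) atTop (𝓝 0) := by
      simpa using ENNReal.tendsto_ofReal hb
    simpa using ENNReal.Tendsto.sub (tendsto_const_nhds (x := (1 : ENNReal))) h1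
      (Or.inl ENNReal.one_ne_top)
  refine tendsto_of_tendsto_of_tendsto_of_le_of_le' h0 tendsto_const_nhds ?_
    (Eventually.of_forall fun n => prob_le_one)
  filter_upwards [hA] with n hn
  set μ := setBernoulli (Set.univ : Set {e : Finset (Fin n) // e.card = k}) (p n)
  have h1 : μ {H | ¬ A n H} ≤ ENNReal.ofReal (b n) := by
    rw [← ofReal_measureReal]
    exact ENNReal.ofReal_le_ofReal hn
  rw [tsub_le_iff_right]
  calc (1 : ENNReal) = μ Set.univ := measure_univ.symm
    _ = μ ({H | A n H} ∪ {H | ¬ A n H}) := by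
      congr 1
      ext H
      simp [em]
    _ ≤ μ {H | A n H} + μ {H | ¬ A n H} := measure_union_le _ _
    _ ≤ _ := by gcongr

/-! ### The subcritical regime -/

theorem gain_empty {V : Type*} [DecidableEq V] {k j : ℕ} {x : SearchQuery V k}
    (hx : x.2 ⊆ (x.1 : Finset V)) (hj : x.2.card = j) :
    x.gain j ∅ = k.choose j - 1 := by
  unfold SearchQuery.gain
  have : (Finset.powersetCard j (x.1 : Finset V)).filter (fun J => ∅ ⊆ J ∧ J ≠ x.2) =
      (Finset.powersetCard j (x.1 : Finset V)).erase x.2 := by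
    ext J
    simp
    tauto
  rw [this, Finset.card_erase_of_mem (Finset.mem_powersetCard.2 ⟨hx, hj⟩),
    Finset.card_powersetCard, x.1.2]

theorem exp_sub_one_le {x : ℝ} (hx0 : 0 ≤ x) (hx1 : x ≤ 1) : Real.exp x - 1 ≤ x * (1 + x) := by
  have h := Real.abs_exp_sub_one_sub_id_le (x := x) (by rw [abs_le]; constructor <;> linarith)
  have := (abs_le.1 h).2
  nlinarith

/-- The search that explores the component of `J₀` until `m` sets are discovered. -/
noncomputable def componentSearch {V : Type*} (k j : ℕ) (J₀ : Finset V) (m : ℝ) :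
    SearchRule V k where
  j := j
  allowed _ _ := True
  finished s := m ≤ s.discovered.card
  idleStop _ := False
  pool := {J₀}

section Subcritical

variable {V : Type*} [DecidableEq V] {k j : ℕ}

/-- If the search ends before discovering `m` sets, it has discovered the whole component. -/
theorem ncard_component_le_of_not_finished {J₀ : {s : Finset V // s.card = j}} {m : ℝ}
    {H : UniformHypergraph V k} {s : SearchState V k}
    (hc : (componentSearch k j (J₀ : Finset V) m).Consistent H s)
    (hh : (componentSearch k j (J₀ : Finset V) m).Halted s) (hs : (s.discovered.card : ℝ) < m) :
    {J | H.TupleConnected j J₀ J}.ncard ≤ s.discovered.card := by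
  have h1 := hh.resolve_left (not_le.2 hs)
  have h2 : (J₀ : Finset V) ∈ s.discovered :=
    (h1.2.resolve_left id) (Finset.mem_singleton_self _)
  have h3 : ∀ J, H.TupleConnected j J₀ J → (J : Finset V) ∈ s.discovered := by
    intro J hJ
    induction hJ with
    | refl => exact h2
    | @tail _ J' _ h ih =>
      obtain ⟨e, he, h4, h5⟩ := h
      have h6 : ∃ y ∈ s.queried, y.1 = e := by
        by_contra h7
        push Not at h7
        exact h1.1 (e, _) ⟨h7, ih, h4, trivial⟩
      obtain ⟨y, hy, rfl⟩ := h6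
      exact hc.subset_discovered y ((hc.mem_found y).2 ⟨hy, he⟩)
        (Finset.mem_powersetCard.2 ⟨h5, J'.2⟩)
  rw [← Set.ncard_coe_finset]
  refine Set.ncard_le_ncard_of_injOn (fun J => (J : Finset V)) (fun J hJ => h3 J hJ)
    (fun J _ J' _ h => Subtype.ext h) (Finset.finite_toSet _)

/-- The component of a given `j`-set has at least `m` elements with exponentially small
probability. -/
theorem component_tail_le [Fintype V] (hj : 1 ≤ j) (hjk : j < k) (p : unitInterval) {ε m : ℝ} (hε0 : 0 < ε)
    (hε1 : ε ≤ 1) (hm : 0 < m)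
    (hp : (p : ℝ) * ((Fintype.card V - j).choose (k - j) : ℝ) * ((k.choose j - 1 : ℕ) : ℝ) ≤ 1 - ε)
    (J₀ : {s : Finset V // s.card = j}) :
    (setBernoulli (Set.univ : Set {e : Finset V // e.card = k}) p).real
      {H | m ≤ ({J | UniformHypergraph.TupleConnected H j J₀ J}.ncard : ℝ)} ≤
      Real.exp (2 ^ k - ε ^ 2 * m / (4 * ((k.choose j - 1 : ℕ) : ℝ))) := by
  classical
  set r : ℝ := ((k.choose j - 1 : ℕ) : ℝ) with hr
  set N : ℝ := ((Fintype.card V - j).choose (k - j) : ℝ) with hN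
  have hr1 : 1 ≤ r := by
    have := two_le_choose hj hjk
    rw [hr]
    exact_mod_cast (by omega : 1 ≤ k.choose j - 1)
  set R := componentSearch k j (J₀ : Finset V) m with hR
  set T := Fintype.card {e : Finset V // e.card = k} + R.pool.card + 1 with hT
  have hpool : ∀ J ∈ R.pool, J.card = R.j := by
    intro J hJ
    rw [Finset.mem_singleton.1 hJ]
    exact J₀.2
  have hbound := R.measureReal_potential_le p (fun _ => ε / 2) T
    (ε ^ 2 * m / (4 * r) - 2 ^ k)
  rw [neg_sub] at hbound
  refine le_trans (measureReal_mono ?_ (measure_ne_top _ _)) hbound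
  intro (H : UniformHypergraph V k) hH
  simp only [Set.mem_ofPred_eq] at hH ⊢
  have hc := SearchRule.consistent_run (R := R) (H := H) hpool T
  have hh := SearchRule.halted_run (R := R) (H := H) hpool (Nat.lt_succ_self _)
  change R.Halted (R.run H T) at hh
  have hup := SearchRule.upDegree_run_lt (R := R) (H := H) (L := ∅) hm
    (fun s hs => by rwa [SearchRule.upDegree_empty] at hs) T
  have hdeg := SearchRule.upDegree_run_le (R := R) (H := H) hpool ∅ T
  generalize R.run H T = s at hc hh hup hdeg
  have hQ := SearchRule.card_queried_parent_above_le hjk.le hc ∅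
  rw [SearchRule.upDegree_empty] at hup hQ
  rw [SearchRule.upDegree_empty, SearchRule.upDegree_empty] at hdeg
  simp only [Finset.empty_subset, Finset.filter_true] at hQ
  have hD : m ≤ (s.discovered.card : ℝ) := by
    by_contra h
    have := ncard_component_le_of_not_finished hc hh (not_le.1 h)
    have : ({J | H.TupleConnected j J₀ J}.ncard : ℝ) ≤ s.discovered.card := by exact_mod_cast this
    linarith
  have hS : s.seeds.card ≤ 1 := Finset.card_le_card hc.seeds_subset_pool
  have hgain : ∑ x ∈ s.found, x.gain R.j ∅ = s.found.card * (k.choose j - 1) := by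
    refine Finset.sum_const_nat fun x hx => ?_
    have := hc.parent_mem x (s.found_subset hx)
    exact gain_empty this.2 (hc.card_eq _ this.1)
  rw [hgain] at hdeg
  have hF : m ≤ 1 + s.found.card * r := by
    refine hD.trans ?_
    rw [hr]
    exact_mod_cast hdeg.trans (Nat.add_le_add_right hS _)
  have hQ' : (s.queried.card : ℝ) ≤ (m + 2 ^ k) * N := by
    have : (s.queried.card : ℝ) ≤ s.discovered.card * N := by
      rw [hN]
      exact_mod_cast hQ
    refine this.trans ?_
    have : 0 ≤ N := Nat.cast_nonneg _
    gcongr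
  rw [Finset.sum_const, Finset.sum_const, nsmul_eq_mul, nsmul_eq_mul]
  have hexp := exp_sub_one_le (x := ε / 2) (by linarith) (by linarith)
  set M : ℝ := 2 ^ k with hM
  have hM1 : 1 ≤ M := one_le_pow₀ one_le_two
  have hp0 : 0 ≤ (p : ℝ) := p.2.1
  -- the contribution of the queries
  have hq : (p : ℝ) * (s.queried.card * (Real.exp (ε / 2) - 1)) * r ≤
      ε / 2 * ((1 - ε / 2) * (m + M)) := by
    calc (p : ℝ) * (s.queried.card * (Real.exp (ε / 2) - 1)) * r
        ≤ p * (((m + M) * N) * (ε / 2 * (1 + ε / 2))) * r := by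
          gcongr
          linarith [Real.add_one_le_exp (ε / 2)]
      _ = (p * N * r) * ((m + M) * (ε / 2 * (1 + ε / 2))) := by ring
      _ ≤ (1 - ε) * ((m + M) * (ε / 2 * (1 + ε / 2))) := by gcongr
      _ = ε / 2 * (((1 - ε) * (1 + ε / 2)) * (m + M)) := by ring
      _ ≤ ε / 2 * ((1 - ε / 2) * (m + M)) := by
          gcongr
          nlinarith
  have hfin : (ε ^ 2 * m / 4 - M) ≤
      (s.found.card * (ε / 2) - p * (s.queried.card * (Real.exp (ε / 2) - 1))) * r := by
    have h1 : (m - 1) * (ε / 2) ≤ s.found.card * r * (ε / 2) := by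
      gcongr
      linarith
    nlinarith
  have hr0 : 0 < r := by linarith
  have h5 : ε ^ 2 * m / (4 * r) - M ≤ (ε ^ 2 * m / 4 - M) / r := by
    rw [sub_div, div_div]
    have : M / r ≤ M := div_le_self (by linarith) hr1
    linarith
  refine h5.trans ?_
  rw [div_le_iff₀ hr0]
  exact hfin

end Subcritical

/-- Below the threshold, all components are small: the component of each `j`-set is bounded by
`component_tail_le`, and there are at most `n ^ j` of them. -/
theorem holdsAAS_small_components {k j : ℕ} (hj : 1 ≤ j) (hjk : j < k) {ε : ℕ → ℝ}
    {p : ℕ → unitInterval} (hε : ∀ᶠ n in atTop, 0 < ε n)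
    (hp : ∀ᶠ n in atTop, (p n : ℝ) = (1 - ε n) * thresholdProb k j n) :
    HoldsAAS k p (fun n H => ∀ K ∈ H.tupleComponents j, (K.ncard : ℝ) ≤
      4 * ((k.choose j - 1 : ℕ) : ℝ) * (j + 1) * ((ε n)⁻¹ ^ 2 * Real.log n)) := by
  set r : ℝ := ((k.choose j - 1 : ℕ) : ℝ) with hr
  have hr1 : 1 ≤ r := by
    have := two_le_choose hj hjk
    rw [hr]
    exact_mod_cast (by omega : 1 ≤ k.choose j - 1)
  refine holdsAAS_of_eventually_le (b := fun n => Real.exp (2 ^ k) * (n : ℝ)⁻¹) ?_ ?_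
  · simpa using (tendsto_inv_atTop_nhds_zero_nat (𝕜 := ℝ)).const_mul (Real.exp (2 ^ k))
  filter_upwards [hε, hp, eventually_ge_atTop 2, eventually_ge_atTop k] with n hε0 hpn hn2 hnk
  have hn0 : (0 : ℝ) < n := by exact_mod_cast (by omega : 0 < n)
  have hlog : 0 < Real.log n := Real.log_pos (by exact_mod_cast (by omega : 1 < n))
  have hth : 0 < thresholdProb k j n := by
    rw [thresholdProb_eq hj hjk]
    have := Nat.factorial_pos (k - j)
    positivity
  have hε1 : ε n ≤ 1 := by
    have h1 := (p n).2.1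
    rw [hpn] at h1
    have := nonneg_of_mul_nonneg_left h1 hth
    linarith
  set m : ℝ := 4 * r * (j + 1) * ((ε n)⁻¹ ^ 2 * Real.log n) with hm
  have hm0 : 0 < m := by positivity
  have hpN : (p n : ℝ) * ((Fintype.card (Fin n) - j).choose (k - j) : ℝ) * r ≤ 1 - ε n := by
    rw [hpn, thresholdProb_eq hj hjk, Fintype.card_fin, ← hr]
    have h1 := choose_mul_factorial_le n j k
    have h2 : 0 ≤ 1 - ε n := by linarith
    calc _ = (1 - ε n) * ((((n - j).choose (k - j) : ℝ) * ((k - j).factorial : ℝ)) /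
          (n : ℝ) ^ (k - j)) := by field_simp
      _ ≤ (1 - ε n) * 1 := by
          gcongr
          rw [div_le_one (by positivity)]
          exact h1
      _ = _ := mul_one _
  have htail : ∀ J₀ : {s : Finset (Fin n) // s.card = j}, _ :=
    fun J₀ => component_tail_le (V := Fin n) hj hjk (p n) hε0 hε1 hm0 hpN J₀
  have hexp : (2 : ℝ) ^ k - ε n ^ 2 * m / (4 * r) = 2 ^ k - (j + 1) * Real.log n := by
    rw [hm]
    field_simp
  rw [← hr] at htail
  simp only [hexp] at htail
  have hsub : {H : UniformHypergraph (Fin n) k | ¬ ∀ K ∈ H.tupleComponents j, (K.ncard : ℝ) ≤ m} ⊆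
      ⋃ J₀ ∈ (Finset.univ : Finset {s : Finset (Fin n) // s.card = j}),
        {H | m ≤ ({J | UniformHypergraph.TupleConnected H j J₀ J}.ncard : ℝ)} := by
    intro H hH
    simp only [Set.mem_ofPred_eq, not_forall, not_le] at hH
    obtain ⟨K, ⟨J₀, rfl⟩, hK⟩ := hH
    simp only [Set.mem_iUnion]
    refine ⟨J₀, Finset.mem_univ _, ?_⟩
    have h1 : {J | H.TupleConnected j J₀ J} = {x | (H.tupleSetoid j) x J₀} := by
      ext J
      exact ⟨fun h => (H.tupleSetoid j).symm' h, fun h => (H.tupleSetoid j).symm' h⟩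
    simp only [Set.mem_ofPred_eq]
    rw [h1]
    exact hK.le
  refine (measureReal_mono hsub (measure_ne_top _ _)).trans
    ((measureReal_biUnion_finset_le _ _).trans ((Finset.sum_le_sum fun J₀ _ => htail J₀).trans ?_))
  rw [Finset.sum_const, nsmul_eq_mul, Finset.card_univ, Fintype.card_finset_len, Fintype.card_fin,
    Real.exp_sub]
  have h1 : (n.choose j : ℝ) ≤ (n : ℝ) ^ j := by exact_mod_cast Nat.choose_le_pow n j
  have h2 : Real.exp ((j + 1) * Real.log n) = (n : ℝ) ^ (j + 1) := by
    rw [show ((j : ℝ) + 1) * Real.log n = ((j + 1 : ℕ) : ℝ) * Real.log n by push_cast; ring,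
      Real.exp_nat_mul, Real.exp_log hn0]
  rw [h2]
  calc _ ≤ (n : ℝ) ^ j * (Real.exp (2 ^ k) / (n : ℝ) ^ (j + 1)) := by gcongr
    _ = _ := by rw [pow_succ]; field_simp

/-! ### A spread-out family of `j`-sets -/

/-- In a finite abelian group, some translate of the condition `∑ v ∈ J, v ∈ S` defines a family of
`j`-sets that is at least as large as `S` makes expect, and no small set `L` lies in many members:
all but one of the elements outside `L` can be chosen freely. -/
theorem exists_spread_family {V : Type*} [Fintype V] [DecidableEq V] [AddCommGroup V] (j : ℕ)
    (S : Finset V) :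
    ∃ P : Finset (Finset V), (∀ J ∈ P, J.card = j) ∧
      (Fintype.card V).choose j * S.card ≤ P.card * Fintype.card V ∧
      ∀ L : Finset V, L.card < j →
        upDegree P L ≤ Fintype.card V ^ (j - 1 - L.card) * S.card := by
  set P : V → Finset (Finset V) := fun a =>
    (Finset.powersetCard j Finset.univ).filter fun J => ∑ v ∈ J, v + a ∈ S with hP
  have hcount : ∀ c : V, (Finset.univ.filter fun a => c + a ∈ S).card = S.card := by
    intro c
    refine Finset.card_bij (fun a _ => c + a) (fun a ha => (Finset.mem_filter.1 ha).2)
      (fun a _ b _ h => add_left_cancel h) fun b hb => ⟨-c + b, ?_, by abel⟩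
    simpa using hb
  have hsum : ∑ a, (P a).card = (Fintype.card V).choose j * S.card := by
    simp only [hP, Finset.card_filter]
    rw [Finset.sum_comm]
    simp only [← Finset.card_filter, hcount]
    rw [Finset.sum_const, Finset.card_powersetCard, Finset.card_univ, smul_eq_mul]
  obtain ⟨a, -, ha⟩ : ∃ a ∈ (Finset.univ : Finset V),
      (Fintype.card V).choose j * S.card ≤ (P a).card * Fintype.card V := by
    by_contra! h
    have h1 : ∑ a : V, (P a).card * Fintype.card V <
        ∑ _a : V, (Fintype.card V).choose j * S.card :=
      Finset.sum_lt_sum_of_nonempty ⟨0, Finset.mem_univ _⟩ h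
    rw [← Finset.sum_mul, hsum, Finset.sum_const, smul_eq_mul, Finset.card_univ, mul_comm] at h1
    exact lt_irrefl _ h1
  refine ⟨P a, fun J hJ => (Finset.mem_powersetCard.1 (Finset.mem_filter.1 hJ).1).2, ha,
    fun L hL => ?_⟩
  have hsub : (P a).filter (fun J => L ⊆ J) ⊆
      ((Finset.powersetCard (j - 1) Finset.univ).filter fun M => L ⊆ M).biUnion fun M =>
        (Finset.univ.filter fun v => ∑ u ∈ M, u + a + v ∈ S).image fun v => insert v M := by
    intro J hJ
    simp only [hP, Finset.mem_filter, Finset.mem_powersetCard, Finset.subset_univ,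
      true_and] at hJ
    obtain ⟨⟨h1, h2⟩, h3⟩ := hJ
    obtain ⟨v, hv, hvL⟩ : ∃ v ∈ J, v ∉ L := by
      by_contra! h
      have := Finset.card_le_card h
      omega
    simp only [Finset.mem_biUnion, Finset.mem_filter, Finset.mem_powersetCard,
      Finset.subset_univ, true_and, Finset.mem_image, Finset.mem_univ]
    refine ⟨J.erase v, ⟨by rw [Finset.card_erase_of_mem hv, h1], Finset.subset_erase.2 ⟨h3, hvL⟩⟩,
      v, ?_, Finset.insert_erase hv⟩
    rwa [add_right_comm, Finset.sum_erase_add _ _ hv]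
  calc upDegree (P a) L ≤ _ := Finset.card_le_card hsub
    _ ≤ _ := Finset.card_biUnion_le
    _ ≤ ∑ _M ∈ (Finset.powersetCard (j - 1) (Finset.univ : Finset V)).filter fun M => L ⊆ M,
          S.card := by
      refine Finset.sum_le_sum fun M _ => Finset.card_image_le.trans (hcount _).le
    _ = (Fintype.card V - L.card).choose (j - 1 - L.card) * S.card := by
      rw [Finset.sum_const, smul_eq_mul, Finset.card_filter_powersetCard_subset _ _ _
        (Finset.subset_univ _) (by omega), Finset.card_univ]
    _ ≤ _ := by
      refine Nat.mul_le_mul_right _ ((Nat.choose_le_pow _ _).trans ?_)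
      exact Nat.pow_le_pow_left (Nat.sub_le _ _) _

/-! ### The search for a large component -/

/-- The search for a large component. It only queries `k`-sets with a single discovered `j`-set
inside, so that finding an edge always yields `k.choose j - 1` new `j`-sets. It stops as soon as
some `i`-set with `i < j` lies in `β i` discovered `j`-sets (for `i = 0`: as soon as `β 0` sets are
discovered), or if it runs out of queries after making at least `y / p` of them. -/
noncomputable def giantSearch {V : Type*} [DecidableEq V] (k j : ℕ) (p y : ℝ) (β : ℕ → ℝ)
    (P : Finset (Finset V)) : SearchRule V k where
  j := j
  allowed s x := x.2 ∈ s.current ∧ ∀ J ∈ s.discovered, J ⊆ (x.1 : Finset V) → J = x.2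
  finished s := ∃ L : Finset V, L.card < j ∧ β L.card ≤ upDegree s.discovered L
  idleStop s := y ≤ p * s.queried.card
  pool := P

section GiantSearch

variable {V : Type*} [DecidableEq V] {k j : ℕ} {p y : ℝ} {β : ℕ → ℝ} {P : Finset (Finset V)}
variable {H : UniformHypergraph V k} {s : SearchState V k}

/-- The invariants of the search for a large component: the current sets are discovered and mutually
connected; a discovered `j`-set that could be used for a query is current; and each edge
found has contributed `k.choose j - 1` discovered sets. -/
structure GiantInvariant (j : ℕ) (H : UniformHypergraph V k) (s : SearchState V k) : Prop where
  current_subset : s.current ⊆ s.discovered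
  mem_current : ∀ e : {e : Finset V // e.card = k}, (∀ y ∈ s.queried, y.1 ≠ e) →
    ∀ J ∈ s.discovered, J ⊆ (e : Finset V) →
    (∀ J' ∈ s.discovered, J' ⊆ (e : Finset V) → J' = J) → J ∈ s.current
  card_found_le : s.found.card * (k.choose j - 1) ≤ s.discovered.card
  connected : ∀ J J' : {s : Finset V // s.card = j}, (J : Finset V) ∈ s.current →
    (J' : Finset V) ∈ s.current → H.TupleConnected j J J'

theorem giantInvariant_run (hpool : ∀ J ∈ P, J.card = j) (T : ℕ) :
    GiantInvariant j H ((giantSearch k j p y β P).run H T) := by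
  induction T with
  | zero => constructor <;> simp [SearchRule.run_zero, SearchState.init]
  | succ T ih =>
    set R := giantSearch k j p y β P with hR
    have hstep := SearchRule.step_run (R := R) (H := H) T
    have hc := SearchRule.consistent_run (R := R) (H := H) hpool T
    generalize R.run H T = s at ih hstep hc
    generalize R.run H (T + 1) = s' at hstep
    obtain ⟨i1, i2, i3, i4⟩ := ih
    cases hstep with
    | hit x h1 h2 h3 =>
      obtain ⟨e1, e2, e3, e4, e5⟩ := h2
      have hxj := hc.card_eq _ e2
      change x.2.card = j at hxj
      have hRj : R.j = j := rfl
      constructor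
      · exact Finset.union_subset_union i1 (Finset.Subset.refl _)
      · intro e he J hJ hJe hsole
        simp only [SearchState.hit, Finset.mem_insert, Finset.mem_union] at he hJ hsole ⊢
        rcases hJ with hJ | hJ
        · exact Or.inl (i2 e (fun y hy => he y (Or.inr hy)) J hJ hJe
            fun J' hJ' => hsole J' (Or.inl hJ'))
        · exact Or.inr hJ
      · have hxf : x ∉ s.found := fun h => e1 x (s.found_subset h) rfl
        have hdisj : Disjoint s.discovered ((Finset.powersetCard j (x.1 : Finset V)).erase x.2) := by
          rw [Finset.disjoint_left]
          intro J hJ hJ'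
          rw [Finset.mem_erase, Finset.mem_powersetCard] at hJ'
          exact hJ'.1 (e5 J hJ hJ'.2.1)
        have hsub : s.discovered ∪ (Finset.powersetCard j (x.1 : Finset V)).erase x.2 ⊆
            (s.hit R.j x).discovered :=
          Finset.union_subset_union (Finset.Subset.refl _) (Finset.erase_subset _ _)
        have h4 := Finset.card_le_card hsub
        rw [Finset.card_union_of_disjoint hdisj,
          Finset.card_erase_of_mem (Finset.mem_powersetCard.2 ⟨e3, hxj⟩),
          Finset.card_powersetCard, x.1.2] at h4
        refine le_trans ?_ h4
        simp only [SearchState.hit, Finset.card_insert_of_notMem hxf, Nat.add_mul, one_mul]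
        omega
      · have key : ∀ J : {s : Finset V // s.card = j}, (J : Finset V) ∈ (s.hit R.j x).current →
            H.TupleConnected j J ⟨x.2, hxj⟩ := by
          intro J hJ
          simp only [SearchState.hit, Finset.mem_union, Finset.mem_powersetCard] at hJ
          rcases hJ with hJ | hJ
          · exact i4 J ⟨x.2, hxj⟩ hJ e4
          · exact Relation.ReflTransGen.single ⟨x.1, h3, hJ.1, e3⟩
        exact fun J J' hJ hJ' => (H.tupleSetoid j).trans' (key J hJ)
          ((H.tupleSetoid j).symm' (key J' hJ'))
    | miss x h1 h2 h3 =>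
      refine ⟨i1, fun e he => i2 e fun y hy => ?_, i3, i4⟩
      exact he y (Finset.mem_insert_of_mem hy)
    | addSeed J h1 h2 h3 h4 h5 =>
      constructor
      · simp [SearchState.addSeed]
      · intro e he J' hJ' hJe hsole
        simp only [SearchState.addSeed, Finset.mem_insert, Finset.mem_singleton] at he hJ' hsole ⊢
        rcases hJ' with hJ' | hJ'
        · exact hJ'
        -- an earlier set cannot be usable for a query now, as it would have been before
        · have h6 : ∀ J'' ∈ s.discovered, J'' ⊆ (e : Finset V) → J'' = J' :=
            fun J'' h7 => hsole J'' (Or.inr h7)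
          exact absurd ⟨he, hJ', hJe, i2 e he J' hJ' hJe h6, h6⟩ (h2 (e, J'))
      · exact i3.trans (Finset.card_le_card (Finset.subset_insert _ _))
      · intro J₁ J₂ hJ₁ hJ₂
        simp only [SearchState.addSeed, Finset.mem_singleton] at hJ₁ hJ₂
        rw [Subtype.ext (hJ₁.trans hJ₂.symm)]
        exact Relation.ReflTransGen.refl
    | halted h => exact ⟨i1, i2, i3, i4⟩

/-- At most `b` sets are discovered outside the current component, if at most `b` sets are
discovered whenever a new seed is taken. -/
theorem card_discovered_sdiff_current_le {R : SearchRule V k} {b : ℕ}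
    (hb : ∀ T, ¬ R.finished (R.run H T) → (∀ x, ¬ R.Eligible (R.run H T) x) →
      ¬ R.idleStop (R.run H T) → (R.run H T).discovered.card ≤ b) (T : ℕ) :
    ((R.run H T).discovered \ (R.run H T).current).card ≤ b := by
  induction T with
  | zero => simp [SearchRule.run_zero, SearchState.init]
  | succ T ih =>
    have hstep := SearchRule.step_run (R := R) (H := H) T
    have hbT := hb T
    generalize R.run H T = s at ih hstep hbT
    generalize R.run H (T + 1) = s' at hstep
    cases hstep with
    | hit x h1 h2 h3 =>
      refine le_trans (Finset.card_le_card ?_) ih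
      intro J
      simp only [SearchState.hit, Finset.mem_sdiff, Finset.mem_union]
      tauto
    | miss x h1 h2 h3 => exact ih
    | addSeed J h1 h2 h3 h4 h5 =>
      refine le_trans (Finset.card_le_card ?_) (hbT h1 h2 h3)
      intro J'
      simp only [SearchState.addSeed, Finset.mem_sdiff, Finset.mem_insert, Finset.mem_singleton]
      tauto
    | halted h => exact ih

end GiantSearch

/-! ### Degrees stay bounded during the search -/

section Gain

variable {V : Type*} [DecidableEq V] {k j : ℕ} {L : Finset V} {x : SearchQuery V k}

theorem gain_eq_zero (h : ¬ L ⊆ (x.1 : Finset V)) : x.gain j L = 0 := by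
  unfold SearchQuery.gain
  rw [Finset.card_eq_zero, Finset.filter_eq_empty_iff]
  intro J hJ hLJ
  exact h (hLJ.1.trans (Finset.mem_powersetCard.1 hJ).1)

/-- Above a nonempty `L`, the branching is strictly smaller than in total, as some `j`-set inside
the queried `k`-set does not contain `L`. -/
theorem gain_le_of_subset_parent (hjk : j < k) (hL : L.Nonempty) (hLx : L ⊆ x.2)
    (hx : x.2 ⊆ (x.1 : Finset V)) (hxj : x.2.card = j) : x.gain j L ≤ k.choose j - 1 - 1 := by
  obtain ⟨v, hv⟩ := hL
  have hvx : v ∈ (x.1 : Finset V) := hx (hLx hv)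
  obtain ⟨J, hJ, hJc⟩ : ∃ J ⊆ (x.1 : Finset V).erase v, J.card = j := by
    refine Finset.exists_subset_card_eq ?_
    rw [Finset.card_erase_of_mem hvx, x.1.2]
    omega
  have hvJ : v ∉ J := fun h => Finset.notMem_erase v _ (hJ h)
  have h1 : (Finset.powersetCard j (x.1 : Finset V)).filter (fun J => L ⊆ J ∧ J ≠ x.2) ⊆
      ((Finset.powersetCard j (x.1 : Finset V)).erase x.2).erase J := by
    intro J' hJ'
    rw [Finset.mem_filter] at hJ'
    refine Finset.mem_erase.2 ⟨?_, Finset.mem_erase.2 ⟨hJ'.2.2, hJ'.1⟩⟩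
    rintro rfl
    exact hvJ (hJ'.2.1 hv)
  refine (Finset.card_le_card h1).trans ?_
  rw [Finset.card_erase_of_mem, Finset.card_erase_of_mem, Finset.card_powersetCard, x.1.2]
  · exact Finset.mem_powersetCard.2 ⟨hx, hxj⟩
  · refine Finset.mem_erase.2 ⟨?_, Finset.mem_powersetCard.2 ⟨hJ.trans (Finset.erase_subset _ _), hJc⟩⟩
    rintro rfl
    exact hvJ (hLx hv)

theorem sum_gain_le (hjk : j < k) (hL : L.Nonempty) {Q : Finset (SearchQuery V k)}
    (hQ : ∀ x ∈ Q, x.2 ⊆ (x.1 : Finset V) ∧ x.2.card = j) :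
    ∑ x ∈ Q, x.gain j L ≤ (Q.filter fun x => L ⊆ x.2).card * (k.choose j - 1 - 1) +
      (Q.filter fun x => L ⊆ (x.1 : Finset V) ∧ ¬ L ⊆ x.2).card * 2 ^ k := by
  have h : ∀ x ∈ Q, x.gain j L ≤ (if L ⊆ x.2 then k.choose j - 1 - 1 else 0) +
      (if L ⊆ (x.1 : Finset V) ∧ ¬ L ⊆ x.2 then 2 ^ k else 0) := by
    intro x hx
    by_cases h1 : L ⊆ x.2
    · simpa [h1] using gain_le_of_subset_parent hjk hL h1 (hQ x hx).1 (hQ x hx).2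
    · by_cases h2 : L ⊆ (x.1 : Finset V)
      · simpa [h1, h2] using SearchRule.gain_le j L x
      · simp [gain_eq_zero h2]
  refine (Finset.sum_le_sum h).trans ?_
  rw [Finset.sum_add_distrib, ← Finset.sum_filter, ← Finset.sum_filter, Finset.sum_const,
    Finset.sum_const, smul_eq_mul, smul_eq_mul]

end Gain

/-- The threshold at which the degree of an `i`-set counts as too large: `K ^ i` times the average
degree of an `i`-set in a family of `B` sets, up to a constant factor. -/
noncomputable def degreeThreshold (K B n : ℝ) (i : ℕ) : ℝ := K ^ i * B / n ^ i

/-- The factor `K` in `degreeThreshold` for the search among `k`-sets. -/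
noncomputable def degreeFactor (k : ℕ) : ℝ := 64 * (2 ^ k) ^ 3 * k.factorial

section BadEvents

/-- If the total branching factor `q * r` is close to one, then at most a fraction `1 - 1 / r` of
the branching takes place above a nonempty set. -/
theorem branching_above_le {q r M : ℝ} (hq : 0 ≤ q) (hM : 1 ≤ M) (hrM : r ≤ M)
    (hqr : q * r ≤ 1 + 1 / (8 * M)) :
    q * (r - 1) * (1 + 1 / (8 * M)) ≤ 1 - 1 / (2 * M) := by
  have hM0 : 0 < M := by linarith
  set z := 1 / M with hz
  have hz0 : 0 < z := by positivity
  have hz1 : z ≤ 1 := by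
    rw [hz, div_le_one hM0]
    exact hM
  have e1 : 1 / (8 * M) = z / 8 := by rw [hz]; field_simp
  have e2 : 1 / (2 * M) = z / 2 := by rw [hz]; field_simp
  rw [e1] at hqr ⊢
  rw [e2]
  have h1 : r - 1 ≤ r * (1 - z) := by
    have : r * z ≤ 1 := by
      rw [hz, mul_one_div, div_le_one hM0]
      exact hrM
    linarith
  have h2 : 0 ≤ 1 - z := by linarith
  have h3 : q * (r - 1) ≤ (1 + z / 8) * (1 - z) := by
    calc q * (r - 1) ≤ q * (r * (1 - z)) := mul_le_mul_of_nonneg_left h1 hq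
      _ = (q * r) * (1 - z) := by ring
      _ ≤ _ := mul_le_mul_of_nonneg_right hqr h2
  calc _ ≤ ((1 + z / 8) * (1 - z)) * (1 + z / 8) :=
        mul_le_mul_of_nonneg_right h3 (by positivity)
    _ ≤ 1 - z / 2 := by nlinarith [mul_pos hz0 hz0, mul_pos hz0 (mul_pos hz0 hz0)]

/-- The arithmetic of the bounded degree lemma: `a` and `e` count the queries above `L` and those
entering the sets above `L`, and `b` is the threshold for the degree of `L`. -/
theorem mean_gain_le {p N r M b a e : ℝ} (hp : 0 ≤ p) (hN : 0 ≤ N) (hM : 1 ≤ M) (hr1 : 1 ≤ r)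
    (hrM : r ≤ M) (hqr : p * N * r ≤ 1 + 1 / (8 * M)) (hb : 8 * M ^ 2 ≤ b)
    (ha : a ≤ (b + M) * N) (he : p * e ≤ b / (16 * M ^ 2)) :
    p * (a * (r - 1) + e * M) * (1 + 1 / (8 * M)) ≤ b - 2 * (b / (8 * M)) := by
  have hM0 : 0 < M := by linarith
  have hb0 : 0 < b := lt_of_lt_of_le (by positivity) hb
  have h1 := branching_above_le (mul_nonneg hp hN) hM hrM hqr
  have h8 : 1 / (8 * M) ≤ 1 := by
    rw [div_le_one (by linarith)]
    linarith
  have h7 : M ≤ b / (8 * M) := by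
    rw [le_div_iff₀ (by positivity)]
    nlinarith
  have h2 : p * N * (r - 1) * (1 + 1 / (8 * M)) * (b + M) ≤ b - 4 * (b / (8 * M)) + M := by
    calc _ ≤ (1 - 1 / (2 * M)) * (b + M) := mul_le_mul_of_nonneg_right h1 (by linarith)
      _ = b - b / (2 * M) + M - 1 / (2 * M) * M := by ring
      _ ≤ b - b / (2 * M) + M := by
          have : 0 ≤ 1 / (2 * M) * M := by positivity
          linarith
      _ = _ := by
          have : b / (2 * M) = 4 * (b / (8 * M)) := by field_simp; norm_num
          rw [this]
  have h3 : p * e * (M * (1 + 1 / (8 * M))) ≤ b / (8 * M) := by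
    calc _ ≤ b / (16 * M ^ 2) * (M * (1 + 1 / (8 * M))) :=
          mul_le_mul_of_nonneg_right he (by positivity)
      _ ≤ b / (16 * M ^ 2) * (M * 2) := by
          refine mul_le_mul_of_nonneg_left (mul_le_mul_of_nonneg_left ?_ hM0.le) (by positivity)
          linarith
      _ = _ := by field_simp; norm_num
  have h4 : p * (a * (r - 1)) ≤ p * ((b + M) * N * (r - 1)) :=
    mul_le_mul_of_nonneg_left (mul_le_mul_of_nonneg_right ha (by linarith)) hp
  have h5 : p * (a * (r - 1)) * (1 + 1 / (8 * M)) ≤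
      p * ((b + M) * N * (r - 1)) * (1 + 1 / (8 * M)) :=
    mul_le_mul_of_nonneg_right h4 (by positivity)
  have e5 : p * (a * (r - 1) + e * M) * (1 + 1 / (8 * M)) =
      p * (a * (r - 1)) * (1 + 1 / (8 * M)) + p * e * (M * (1 + 1 / (8 * M))) := by ring
  have e6 : p * ((b + M) * N * (r - 1)) * (1 + 1 / (8 * M)) =
      p * N * (r - 1) * (1 + 1 / (8 * M)) * (b + M) := by ring
  rw [e6] at h5
  rw [e5]
  linarith

variable {V : Type*} [Fintype V] [DecidableEq V] {k j : ℕ}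

theorem one_le_degreeFactor (k : ℕ) : 1 ≤ degreeFactor k := by
  have hf1 : (1 : ℝ) ≤ k.factorial := by exact_mod_cast Nat.factorial_pos k
  have hM1 : (1 : ℝ) ≤ (2 ^ k) ^ 3 := one_le_pow₀ (one_le_pow₀ one_le_two)
  unfold degreeFactor
  nlinarith

/-- Few queries enter the sets above `L`, because the degrees of the proper subsets of `L` are
bounded by their thresholds, which are smaller by a factor `degreeFactor k`. -/
theorem mul_card_enter_le {R : SearchRule V k} {H : UniformHypergraph V k} {s : SearchState V k}
    (hc : R.Consistent H s) (hjk : R.j < k) (hV : 0 < Fintype.card V)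
    {p B : ℝ} (hp0 : 0 ≤ p) (hB : 0 ≤ B)
    (hpn : p * ((Fintype.card V : ℝ) ^ k / (Fintype.card V : ℝ) ^ R.j) ≤ 2 * k.factorial)
    {L : Finset V} (hL : L.Nonempty) (hLj : L.card < R.j)
    (hup : ∀ L', L' ⊂ L → (upDegree s.discovered L' : ℝ) ≤
      2 * degreeThreshold (degreeFactor k) B (Fintype.card V) L'.card) :
    p * ((s.queried.filter fun x => L ⊆ (x.1 : Finset V) ∧ ¬ L ⊆ x.2).card : ℝ) ≤
      degreeThreshold (degreeFactor k) B (Fintype.card V) L.card / (16 * (2 ^ k) ^ 2) := by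
  set n : ℝ := (Fintype.card V : ℝ) with hn
  have hn0 : 0 < n := by rw [hn]; exact_mod_cast hV
  set K : ℝ := degreeFactor k with hK
  have hK1 : 1 ≤ K := one_le_degreeFactor k
  have hK0 : 0 < K := by linarith
  have hi1 : 1 ≤ L.card := Finset.card_pos.2 hL
  have hb : ∀ L', L' ⊂ L → (upDegree s.discovered L' : ℝ) * n ^ L'.card ≤
      2 * K ^ (L.card - 1) * B / n ^ R.j * n ^ R.j := by
    intro L' hL'
    have h1 : L'.card < L.card := Finset.card_lt_card hL'
    calc (upDegree s.discovered L' : ℝ) * n ^ L'.card ≤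
          (2 * degreeThreshold K B n L'.card) * n ^ L'.card :=
          mul_le_mul_of_nonneg_right (hup L' hL') (by positivity)
      _ = 2 * B * K ^ L'.card := by
          rw [degreeThreshold]
          field_simp
      _ ≤ 2 * B * K ^ (L.card - 1) :=
          mul_le_mul_of_nonneg_left (pow_le_pow_right₀ hK1 (by omega)) (by positivity)
      _ = _ := by field_simp
  have h4 := SearchRule.card_queried_enter_le hc L hV (b := 2 * K ^ (L.card - 1) * B / n ^ R.j)
    (by positivity) hb
  rw [← hn] at h4
  have h5 : (2 : ℝ) ^ L.card ≤ 2 ^ k := pow_le_pow_right₀ one_le_two (by omega)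
  have hKi : K ^ L.card = K * K ^ (L.card - 1) := by
    rw [← pow_succ', Nat.sub_add_cancel hi1]
  calc _ ≤ p * (2 ^ L.card * (2 * K ^ (L.card - 1) * B / n ^ R.j * (n ^ k / n ^ L.card))) :=
        mul_le_mul_of_nonneg_left h4 hp0
    _ = (p * (n ^ k / n ^ R.j)) * (2 ^ L.card * (2 * K ^ (L.card - 1) * B / n ^ L.card)) := by
        ring
    _ ≤ (2 * k.factorial) * (2 ^ k * (2 * K ^ (L.card - 1) * B / n ^ L.card)) := by
        gcongr
    _ = _ := by
        rw [degreeThreshold, hKi]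
        nth_rewrite 2 [hK]
        rw [degreeFactor]
        field_simp
        ring

/-- The bounded degree lemma. The discovered sets above `L` reproduce with a branching factor
bounded away from one, so their number is comparable to the number of times that the search enters
the sets above `L`. -/
theorem degree_tail_le (hj : 1 ≤ j) (hjk : j < k) (hV : 0 < Fintype.card V)
    (p : unitInterval) {B y : ℝ} (hB : 0 ≤ B) {P : Finset (Finset V)}
    (hpool : ∀ J ∈ P, J.card = j)
    (hpN : (p : ℝ) * ((Fintype.card V - j).choose (k - j) : ℝ) * ((k.choose j - 1 : ℕ) : ℝ) ≤
      1 + 1 / (8 * 2 ^ k))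
    (hpn : (p : ℝ) * ((Fintype.card V : ℝ) ^ k / (Fintype.card V : ℝ) ^ j) ≤ 2 * k.factorial)
    (hβ : ∀ i < j, 8 * (2 ^ k) ^ 2 ≤ degreeThreshold (degreeFactor k) B (Fintype.card V) i)
    {L : Finset V} (hL : L.Nonempty) (hLj : L.card < j)
    (hP : 8 * 2 ^ k * (upDegree P L : ℝ) ≤
      degreeThreshold (degreeFactor k) B (Fintype.card V) L.card) (T : ℕ) :
    (setBernoulli (Set.univ : Set {e : Finset V // e.card = k}) p).real
      {H | degreeThreshold (degreeFactor k) B (Fintype.card V) L.card ≤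
        upDegree ((giantSearch k j p y
          (degreeThreshold (degreeFactor k) B (Fintype.card V)) P).run H T).discovered L} ≤
      Real.exp (-(degreeThreshold (degreeFactor k) B (Fintype.card V) L.card /
        (64 * (2 ^ k) ^ 3))) := by
  have hMdef : ∃ M : ℝ, M = 2 ^ k := ⟨_, rfl⟩
  obtain ⟨M, hM⟩ := hMdef
  have hM1 : 1 ≤ M := hM ▸ one_le_pow₀ one_le_two
  have hM0 : 0 < M := by linarith
  obtain ⟨β, hβdef⟩ : ∃ β, β = degreeThreshold (degreeFactor k) B (Fintype.card V) := ⟨_, rfl⟩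
  obtain ⟨r, hr⟩ : ∃ r : ℝ, r = ((k.choose j - 1 : ℕ) : ℝ) := ⟨_, rfl⟩
  obtain ⟨N, hN⟩ : ∃ N : ℝ, N = ((Fintype.card V - j).choose (k - j) : ℝ) := ⟨_, rfl⟩
  have h2c := two_le_choose hj hjk
  have hr1 : 1 ≤ r := by
    rw [hr]
    exact_mod_cast (by omega : 1 ≤ k.choose j - 1)
  have hrM : r ≤ M := by
    rw [hr, hM]
    exact_mod_cast (Nat.sub_le _ _).trans (Nat.choose_le_two_pow k j)
  have hr' : ((k.choose j - 1 - 1 : ℕ) : ℝ) = r - 1 := by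
    rw [Nat.cast_sub (by omega), hr]
    simp
  have hp0 : 0 ≤ (p : ℝ) := p.2.1
  have hβ0 : ∀ i < j, 0 < β i := fun i hi =>
    lt_of_lt_of_le (by positivity) (hβdef ▸ hβ i hi)
  have hMβ : ∀ i < j, M ≤ β i := fun i hi => by
    refine le_trans ?_ (hβdef ▸ hβ i hi)
    rw [← hM]
    nlinarith
  have hθ : ∃ θ : ℝ, θ = 1 / (8 * M ^ 2) := ⟨_, rfl⟩
  obtain ⟨θ, hθ⟩ := hθ
  have hθ0 : 0 < θ := by rw [hθ]; positivity
  have hθM : θ * M = 1 / (8 * M) := by rw [hθ]; field_simp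
  have hθM1 : θ * M ≤ 1 := by
    rw [hθM, div_le_one (by positivity)]
    linarith
  have hfin : ∀ L' : Finset V, L'.card < j → ∀ s : SearchState V k,
      β L'.card ≤ upDegree s.discovered L' → (giantSearch k j p y β P).finished s :=
    fun L' hL' s hs => ⟨L', hL', hs⟩
  have hRj : (giantSearch k j p y β P).j = j := rfl
  have hRpool : (giantSearch k j p y β P).pool = P := rfl
  have hpool' : ∀ J ∈ (giantSearch k j p y β P).pool, J.card = (giantSearch k j p y β P).j := hpool
  rw [← hβdef] at hP ⊢
  rw [← hM] at hP ⊢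
  rw [← hM, ← hN, ← hr] at hpN
  generalize giantSearch k j p y β P = R at hfin hRj hRpool hpool' ⊢
  have hbound := R.measureReal_potential_le p (fun x => θ * (x.gain j L : ℝ)) T
    (β L.card / (64 * M ^ 3))
  refine le_trans (measureReal_mono ?_ (measure_ne_top _ _)) hbound
  intro (H : UniformHypergraph V k) hH
  simp only [Set.mem_ofPred_eq] at hH ⊢
  have hc := SearchRule.consistent_run (H := H) hpool' T
  have hdeg := SearchRule.upDegree_run_le (H := H) hpool' L T
  have hup : ∀ L' : Finset V, L'.card < j →
      (upDegree (R.run H T).discovered L' : ℝ) < β L'.card + M := fun L' hL' =>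
    hM ▸ SearchRule.upDegree_run_lt (H := H) (hβ0 _ hL') (hfin L' hL') T
  generalize R.run H T = s at hH hc hdeg hup ⊢
  -- queries whose parent contains `L`
  have hA : ((s.queried.filter fun x => L ⊆ x.2).card : ℝ) ≤ (β L.card + M) * N := by
    have h1 := SearchRule.card_queried_parent_above_le (by omega) hc L
    rw [hRj] at h1
    have h2 : ((s.queried.filter fun x => L ⊆ x.2).card : ℝ) ≤ upDegree s.discovered L * N := by
      rw [hN]
      exact_mod_cast h1
    refine h2.trans (mul_le_mul_of_nonneg_right (hup L hLj).le ?_)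
    rw [hN]
    exact Nat.cast_nonneg _
  -- queries that enter the sets above `L`
  have hE : (p : ℝ) * ((s.queried.filter fun x => L ⊆ (x.1 : Finset V) ∧ ¬ L ⊆ x.2).card : ℝ) ≤
      β L.card / (16 * M ^ 2) := by
    rw [hβdef, hM]
    refine mul_card_enter_le hc (by omega) hV hp0 hB (hRj ▸ hpn) hL (by omega) fun L' hL' => ?_
    rw [← hβdef]
    have h1 := (Finset.card_lt_card hL').trans hLj
    linarith [hup L' h1, hMβ _ h1]
  have hgain : (p : ℝ) * (∑ x ∈ s.queried, (x.gain j L : ℝ)) * (1 + θ * M) ≤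
      β L.card - 2 * (β L.card / (8 * M)) := by
    have h1 := sum_gain_le hjk hL (Q := s.queried) fun x hx =>
      ⟨(hc.parent_mem x hx).2, (hc.card_eq _ (hc.parent_mem x hx).1).trans hRj⟩
    have h2 : (∑ x ∈ s.queried, (x.gain j L : ℝ)) ≤
        ((s.queried.filter fun x => L ⊆ x.2).card : ℝ) * (r - 1) +
        ((s.queried.filter fun x => L ⊆ (x.1 : Finset V) ∧ ¬ L ⊆ x.2).card : ℝ) * M := by
      rw [← hr', hM]
      exact_mod_cast h1
    have h3 := mean_gain_le hp0 (by rw [hN]; exact Nat.cast_nonneg _) hM1 hr1 hrM hpN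
      (by rw [hβdef, hM]; exact hβ _ hLj) hA hE
    rw [hθM]
    refine le_trans ?_ h3
    exact mul_le_mul_of_nonneg_right (mul_le_mul_of_nonneg_left h2 hp0) (by positivity)
  have hexp : ∀ x ∈ s.queried, Real.exp (θ * (x.gain j L : ℝ)) - 1 ≤
      θ * ((x.gain j L : ℝ) * (1 + θ * M)) := by
    intro x _
    have h1 : (x.gain j L : ℝ) ≤ M := by
      rw [hM]
      exact_mod_cast SearchRule.gain_le j L x
    have h2 : θ * (x.gain j L : ℝ) ≤ θ * M := mul_le_mul_of_nonneg_left h1 hθ0.le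
    have h3 := exp_sub_one_le (x := θ * (x.gain j L : ℝ)) (by positivity) (by linarith)
    refine h3.trans ?_
    rw [mul_assoc]
    gcongr
  have hS : (upDegree s.seeds L : ℝ) ≤ β L.card / (8 * M) := by
    rw [le_div_iff₀ (by positivity)]
    refine le_trans ?_ hP
    rw [mul_comm]
    have : (upDegree s.seeds L : ℝ) ≤ upDegree P L := by
      exact_mod_cast SearchRule.upDegree_mono (hRpool ▸ hc.seeds_subset_pool) L
    exact mul_le_mul_of_nonneg_left this (by positivity)
  have hF : β L.card - β L.card / (8 * M) ≤ ∑ x ∈ s.found, (x.gain j L : ℝ) := by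
    rw [hRj] at hdeg
    have : (upDegree s.discovered L : ℝ) ≤
        upDegree s.seeds L + ∑ x ∈ s.found, (x.gain j L : ℝ) := by
      exact_mod_cast hdeg
    linarith
  have hQ : (p : ℝ) * ∑ x ∈ s.queried, (Real.exp (θ * (x.gain j L : ℝ)) - 1) ≤
      θ * (β L.card - 2 * (β L.card / (8 * M))) := by
    calc _ ≤ (p : ℝ) * ∑ x ∈ s.queried, θ * ((x.gain j L : ℝ) * (1 + θ * M)) :=
          mul_le_mul_of_nonneg_left (Finset.sum_le_sum hexp) hp0
      _ = θ * ((p : ℝ) * (∑ x ∈ s.queried, (x.gain j L : ℝ)) * (1 + θ * M)) := by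
          rw [← Finset.mul_sum, ← Finset.sum_mul]
          ring
      _ ≤ _ := mul_le_mul_of_nonneg_left hgain hθ0.le
  rw [← Finset.mul_sum]
  have hfin : β L.card / (64 * M ^ 3) = θ * (β L.card / (8 * M)) := by
    rw [hθ]
    field_simp
    norm_num
  rw [hfin]
  have h9 := mul_le_mul_of_nonneg_left hF hθ0.le
  linarith

end BadEvents

/-! ### The search does not run out of queries -/

section Idle

variable {V : Type*} [Fintype V] [DecidableEq V] {k j : ℕ} {p y B ε : ℝ} {P : Finset (Finset V)}
variable {H : UniformHypergraph V k} {s : SearchState V k}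

/-- If the search is out of queries while all degrees are bounded, then it has made so many
queries that the edges found among them are fewer than expected, by a factor `1 + ε / 2`. -/
theorem card_discovered_le_of_idle (hjk : j < k) (hV : 0 < Fintype.card V) (hB : 0 ≤ B)
    (hp0 : 0 ≤ p)
    (hε : 1 + ε / 2 ≤ p * ((k.choose j - 1 : ℕ) : ℝ) *
      ((Fintype.card V - j).choose (k - j) - 2 ^ j * (degreeFactor k ^ j * B /
        (Fintype.card V : ℝ) ^ j * ((Fintype.card V : ℝ) ^ k / (Fintype.card V : ℝ) ^ j))))
    (hc : (giantSearch k j p y (degreeThreshold (degreeFactor k) B (Fintype.card V))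
      P).Consistent H s) (hi : GiantInvariant j H s)
    (hfin : ¬ (giantSearch k j p y (degreeThreshold (degreeFactor k) B (Fintype.card V))
      P).finished s)
    (hidle : ∀ x, ¬ (giantSearch k j p y (degreeThreshold (degreeFactor k) B (Fintype.card V))
      P).Eligible s x) :
    (1 + ε / 2) * s.discovered.card ≤ ((k.choose j - 1 : ℕ) : ℝ) * (p * s.queried.card) := by
  set K := degreeFactor k with hK
  have hK1 : 1 ≤ K := one_le_degreeFactor k
  set n : ℝ := (Fintype.card V : ℝ) with hn
  have hn0 : 0 < n := by rw [hn]; exact_mod_cast hV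
  have hsole : ∀ e : {e : Finset V // e.card = k}, ∀ J ∈ s.discovered, J ⊆ (e : Finset V) →
      (∀ J' ∈ s.discovered, J' ⊆ (e : Finset V) → J' = J) → ∃ y ∈ s.queried, y.1 = e := by
    intro e J hJ hJe hJs
    by_contra! h
    exact hidle (e, J) ⟨h, hJ, hJe, hi.mem_current e h J hJ hJe hJs, hJs⟩
  have hb : ∀ J ∈ s.discovered, ∀ L, L ⊂ J → (upDegree s.discovered L : ℝ) * n ^ L.card ≤
      K ^ j * B / n ^ j * n ^ j := by
    intro J hJ L hL
    have hLj : L.card < j := (Finset.card_lt_card hL).trans_eq (hc.card_eq J hJ)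
    have h1 : (upDegree s.discovered L : ℝ) ≤ degreeThreshold K B n L.card := by
      by_contra h
      exact hfin ⟨L, hLj, (not_le.1 h).le⟩
    calc _ ≤ degreeThreshold K B n L.card * n ^ L.card :=
          mul_le_mul_of_nonneg_right h1 (by positivity)
      _ = K ^ L.card * B := by rw [degreeThreshold]; field_simp
      _ ≤ K ^ j * B := mul_le_mul_of_nonneg_right (pow_le_pow_right₀ hK1 hLj.le) hB
      _ = _ := by field_simp
  have h2 := SearchRule.le_card_queried hjk.le hc hV hsole (b := K ^ j * B / n ^ j)
    (by positivity) hb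
  rw [← hn] at h2
  have hr0 : (0 : ℝ) ≤ ((k.choose j - 1 : ℕ) : ℝ) := Nat.cast_nonneg _
  have h3 := mul_le_mul_of_nonneg_left h2 (mul_nonneg hp0 hr0)
  have h4 := mul_le_mul_of_nonneg_right hε (Nat.cast_nonneg (α := ℝ) s.discovered.card)
  calc _ ≤ _ := h4
    _ = _ := by
      rw [mul_assoc (p * _), mul_comm (_ - _) (s.discovered.card : ℝ)]
      rfl
    _ ≤ _ := h3
    _ = _ := by ring

/-- The search is unlikely to run out of queries late, as too few edges would have been found. -/
theorem idle_tail_le (hj : 1 ≤ j) (hjk : j < k) (hV : 0 < Fintype.card V) (hB : 0 ≤ B)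
    (p : unitInterval) (hε0 : 0 < ε) (hε1 : ε ≤ 1)
    (hε : 1 + ε / 2 ≤ p * ((k.choose j - 1 : ℕ) : ℝ) *
      ((Fintype.card V - j).choose (k - j) - 2 ^ j * (degreeFactor k ^ j * B /
        (Fintype.card V : ℝ) ^ j * ((Fintype.card V : ℝ) ^ k / (Fintype.card V : ℝ) ^ j))))
    (hpool : ∀ J ∈ P, J.card = j) (T : ℕ) {R : SearchRule V k}
    (hR : R = giantSearch k j p y (degreeThreshold (degreeFactor k) B (Fintype.card V)) P) :
    (setBernoulli (Set.univ : Set {e : Finset V // e.card = k}) p).real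
      {H | ¬ R.finished (R.run H T) ∧ (∀ x, ¬ R.Eligible (R.run H T) x) ∧ R.idleStop (R.run H T)} ≤
      Real.exp (-(y * (ε ^ 2 / 64))) := by
  have hp0 : 0 ≤ (p : ℝ) := p.2.1
  have hbound := R.measureReal_potential_le p (fun _ => -(ε / 8)) T (y * (ε ^ 2 / 64))
  refine le_trans (measureReal_mono ?_ (measure_ne_top _ _)) hbound
  rintro (H : UniformHypergraph V k) ⟨h1, h2, h3⟩
  simp only [Set.mem_ofPred_eq]
  have hc := SearchRule.consistent_run (R := R) (H := H) (by rw [hR]; exact hpool) T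
  have hi : GiantInvariant j H (R.run H T) := by
    rw [hR]
    exact giantInvariant_run hpool T
  generalize R.run H T = s at h1 h2 h3 hc hi ⊢
  subst hR
  have h4 := card_discovered_le_of_idle hjk hV hB hp0 hε hc hi h1 h2
  change y ≤ (p : ℝ) * s.queried.card at h3
  have h5 := hi.card_found_le
  have h5' : (s.found.card : ℝ) * ((k.choose j - 1 : ℕ) : ℝ) ≤ s.discovered.card := by
    exact_mod_cast h5
  set r : ℝ := ((k.choose j - 1 : ℕ) : ℝ) with hr
  have hr0 : 0 < r := by
    have := two_le_choose hj hjk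
    rw [hr]
    exact_mod_cast (by omega : 0 < k.choose j - 1)
  set q : ℝ := (p : ℝ) * s.queried.card with hq
  have hq0 : 0 ≤ q := by positivity
  have h6 : (1 + ε / 2) * (s.found.card : ℝ) ≤ q := by
    have h7 : r * ((1 + ε / 2) * (s.found.card : ℝ)) ≤ r * q := by
      refine le_trans ?_ h4
      rw [show r * ((1 + ε / 2) * (s.found.card : ℝ)) =
        (1 + ε / 2) * ((s.found.card : ℝ) * r) by ring]
      exact mul_le_mul_of_nonneg_left h5' (by linarith)
    exact le_of_mul_le_mul_left h7 hr0
  have h7 : (s.found.card : ℝ) ≤ (1 - ε / 4) * q := by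
    have h8 : (1 - ε / 4) * ((1 + ε / 2) * (s.found.card : ℝ)) ≤ (1 - ε / 4) * q :=
      mul_le_mul_of_nonneg_left h6 (by linarith)
    have h9 : (1 : ℝ) ≤ (1 - ε / 4) * (1 + ε / 2) := by nlinarith
    have h10 := mul_le_mul_of_nonneg_right h9 (Nat.cast_nonneg (α := ℝ) s.found.card)
    linarith
  have h8 : Real.exp (-(ε / 8)) - 1 ≤ -(ε / 8) + (ε / 8) ^ 2 := by
    have h := Real.abs_exp_sub_one_sub_id_le (x := -(ε / 8))
      (by rw [abs_le]; constructor <;> linarith)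
    have := (abs_le.1 h).2
    rw [neg_sq] at this
    linarith
  rw [Finset.sum_const, Finset.sum_const, nsmul_eq_mul, nsmul_eq_mul, ← mul_assoc, ← hq]
  have h9 := mul_le_mul_of_nonneg_left h8 hq0
  have h10 := mul_le_mul_of_nonneg_right h7 (by linarith : 0 ≤ ε / 8)
  have h11 := mul_le_mul_of_nonneg_right h3 (by positivity : 0 ≤ ε ^ 2 / 64)
  have h12 : q * (ε ^ 2 / 64) ≤ -((1 - ε / 4) * q * (ε / 8)) -
      q * (-(ε / 8) + (ε / 8) ^ 2) := by
    have : 0 ≤ q * ε ^ 2 := by positivity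
    nlinarith
  linarith

end Idle

/-! ### The supercritical regime -/

theorem card_le_ncard_component {V : Type*} [Fintype V] {k j : ℕ} {H : UniformHypergraph V k}
    {G : Finset (Finset V)} (hG : ∀ J ∈ G, J.card = j)
    (hconn : ∀ J J' : {s : Finset V // s.card = j}, (J : Finset V) ∈ G → (J' : Finset V) ∈ G →
      H.TupleConnected j J J') (hne : G.Nonempty) :
    ∃ K ∈ H.tupleComponents j, G.card ≤ K.ncard := by
  obtain ⟨J₀, hJ₀⟩ := hne
  refine ⟨{x | (H.tupleSetoid j) x ⟨J₀, hG J₀ hJ₀⟩}, ⟨_, rfl⟩, ?_⟩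
  have h1 : (G : Set (Finset V)) ⊆ (fun J : {s : Finset V // s.card = j} => (J : Finset V)) ''
      {x | (H.tupleSetoid j) x ⟨J₀, hG J₀ hJ₀⟩} := fun J hJ =>
    ⟨⟨J, hG J hJ⟩, hconn _ _ hJ hJ₀, rfl⟩
  rw [← Set.ncard_coe_finset]
  exact (Set.ncard_le_ncard h1 (Set.toFinite _)).trans (Set.ncard_image_le (Set.toFinite _))

/-- For a given number of vertices, the probability that there is no component with `3 / 4 * B`
sets is at most the probability that some degree gets too large during the search, or that the
search runs out of queries late. -/
theorem giant_tail_le {V : Type*} [Fintype V] [DecidableEq V] {k j : ℕ} (hj : 1 ≤ j) (hjk : j < k)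
    (hV : 0 < Fintype.card V) {B ε : ℝ} (hB : 0 < B) (p : unitInterval) (hε0 : 0 < ε)
    (hε1 : ε ≤ 1) {P : Finset (Finset V)} (hpool : ∀ J ∈ P, J.card = j) (hBP : B ≤ P.card)
    (hε : 1 + ε / 2 ≤ p * ((k.choose j - 1 : ℕ) : ℝ) *
      ((Fintype.card V - j).choose (k - j) - 2 ^ j * (degreeFactor k ^ j * B /
        (Fintype.card V : ℝ) ^ j * ((Fintype.card V : ℝ) ^ k / (Fintype.card V : ℝ) ^ j))))
    (hpN : (p : ℝ) * ((Fintype.card V - j).choose (k - j) : ℝ) * ((k.choose j - 1 : ℕ) : ℝ) ≤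
      1 + 1 / (8 * 2 ^ k))
    (hpn : (p : ℝ) * ((Fintype.card V : ℝ) ^ k / (Fintype.card V : ℝ) ^ j) ≤ 2 * k.factorial)
    (hβ : ∀ i < j, 8 * (2 ^ k) ^ 2 ≤ degreeThreshold (degreeFactor k) B (Fintype.card V) i)
    (hP : ∀ L : Finset V, L.Nonempty → L.card < j → 8 * 2 ^ k * (upDegree P L : ℝ) ≤
      degreeThreshold (degreeFactor k) B (Fintype.card V) L.card) :
    (setBernoulli (Set.univ : Set {e : Finset V // e.card = k}) p).real
      {H | ¬ ∃ K ∈ UniformHypergraph.tupleComponents H j, 3 / 4 * B ≤ (K.ncard : ℝ)} ≤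
      ∑ L ∈ Finset.univ.filter (fun L : Finset V => L.Nonempty ∧ L.card < j),
        Real.exp (-(degreeThreshold (degreeFactor k) B (Fintype.card V) L.card /
          (64 * (2 ^ k) ^ 3))) +
      Real.exp (-(B / (4 * ((k.choose j - 1 : ℕ) : ℝ)) * (ε ^ 2 / 64))) := by
  set r : ℝ := ((k.choose j - 1 : ℕ) : ℝ) with hr
  have hr0 : 0 < r := by
    have := two_le_choose hj hjk
    rw [hr]
    exact_mod_cast (by omega : 0 < k.choose j - 1)
  set y : ℝ := B / (4 * r) with hy
  obtain ⟨R, hR⟩ : ∃ R, R = giantSearch k j (p : ℝ) y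
    (degreeThreshold (degreeFactor k) B (Fintype.card V)) P := ⟨_, rfl⟩
  set T := Fintype.card {e : Finset V // e.card = k} + R.pool.card + 1 with hT
  have hpool' : ∀ J ∈ R.pool, J.card = R.j := by
    rw [hR]
    exact hpool
  have hp0 : 0 ≤ (p : ℝ) := p.2.1
  have hdeg : ∀ L : Finset V, L.Nonempty → L.card < j → _ := fun L hL hLj =>
    degree_tail_le (y := y) hj hjk hV p hB.le hpool hpN hpn hβ hL hLj (hP L hL hLj) T
  rw [← hR] at hdeg
  have hidle := idle_tail_le (y := y) hj hjk hV hB.le p hε0 hε1 hε hpool T hR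
  refine le_trans (measureReal_mono (s₂ := (⋃ L ∈ Finset.univ.filter
      (fun L : Finset V => L.Nonempty ∧ L.card < j),
      {H | degreeThreshold (degreeFactor k) B (Fintype.card V) L.card ≤
        upDegree (R.run H T).discovered L}) ∪
      {H | ¬ R.finished (R.run H T) ∧ (∀ x, ¬ R.Eligible (R.run H T) x) ∧ R.idleStop (R.run H T)})
      ?_ (measure_ne_top _ _)) ?_
  · intro (H : UniformHypergraph V k) hH
    by_contra hbad
    simp only [Set.mem_union, Set.mem_iUnion, Finset.mem_filter, Finset.mem_univ, true_and,
      Set.mem_ofPred_eq, not_or, not_exists, exists_prop, not_and] at hbad hH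
    obtain ⟨hbad1, hbad2⟩ := hbad
    have hc := fun T => SearchRule.consistent_run (R := R) (H := H) hpool' T
    have hi : ∀ T, GiantInvariant j H (R.run H T) := by
      rw [hR]
      exact giantInvariant_run hpool
    have hh : R.Halted (R.run H T) :=
      SearchRule.halted_run (R := R) (H := H) hpool' (Nat.lt_succ_self _)
    have hfin0 : ∀ s : SearchState V k, B ≤ s.discovered.card → R.finished s := by
      intro s hs
      rw [hR]
      refine ⟨∅, by rw [Finset.card_empty]; exact hj, ?_⟩
      rw [SearchRule.upDegree_empty]
      simpa [degreeThreshold] using hs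
    have hfin : R.finished (R.run H T) := by
      by_contra h
      rcases (hh.resolve_left h).2 with h1 | h1
      · exact hbad2 h (hh.resolve_left h).1 h1
      · refine h (hfin0 _ (hBP.trans ?_))
        have h2 : R.pool = P := by rw [hR]; rfl
        rw [h2] at h1
        exact_mod_cast Finset.card_le_card h1
    have hB' : B ≤ (R.run H T).discovered.card := by
      have h1 := hfin
      rw [hR] at h1
      obtain ⟨L, hLj, hL⟩ := h1
      rw [← hR] at hL
      rcases L.eq_empty_or_nonempty with rfl | hne
      · rw [SearchRule.upDegree_empty] at hL
        simpa [degreeThreshold] using hL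
      · exact absurd hL (hbad1 L ⟨hne, hLj⟩)
    have hout : (((R.run H T).discovered \ (R.run H T).current).card : ℝ) ≤ B / 4 := by
      refine (Nat.le_floor_iff (by positivity)).1
        (card_discovered_sdiff_current_le (fun T' h1 h2 h3 => ?_) T)
      refine Nat.le_floor ?_
      have h4 := card_discovered_le_of_idle (s := R.run H T') (H := H) (y := y) (P := P) hjk hV
        hB.le hp0 hε (hR ▸ hc T') (hi T') (by rw [← hR]; exact h1) (by rw [← hR]; exact h2)
      have h5 : (p : ℝ) * (R.run H T').queried.card < y := by
        by_contra h6
        refine h3 ?_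
        have h7 := not_lt.1 h6
        rw [hR] at h7 ⊢
        exact h7
      have h6 : r * ((p : ℝ) * (R.run H T').queried.card) ≤ r * y :=
        mul_le_mul_of_nonneg_left h5.le hr0.le
      have h7 : r * y = B / 4 := by
        rw [hy]
        field_simp
      have h8 : (0 : ℝ) ≤ ε / 2 * (R.run H T').discovered.card := by positivity
      rw [← hr] at h4
      linarith
    have hcur : 3 / 4 * B ≤ (R.run H T).current.card := by
      have h1 := Finset.card_sdiff_add_card_eq_card (hi T).current_subset
      have h2 : (((R.run H T).discovered \ (R.run H T).current).card : ℝ) +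
          (R.run H T).current.card = (R.run H T).discovered.card := by exact_mod_cast h1
      linarith
    have hne : (R.run H T).current.Nonempty := by
      rw [← Finset.card_pos]
      have : (0 : ℝ) < (R.run H T).current.card := by linarith
      exact_mod_cast this
    have hRj : R.j = j := by rw [hR]; rfl
    obtain ⟨K, hK, hKc⟩ := card_le_ncard_component
      (fun J hJ => ((hc T).card_eq J ((hi T).current_subset hJ)).trans hRj) (hi T).connected hne
    refine hH K hK (hcur.trans ?_)
    exact_mod_cast hKc
  · refine (measureReal_union_le _ _).trans (add_le_add ?_ hidle)
    refine (measureReal_biUnion_finset_le _ _).trans (Finset.sum_le_sum fun L hL => ?_)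
    rw [Finset.mem_filter] at hL
    exact hdeg L hL.2.1 hL.2.2

/-! ### Choice of constants in the supercritical regime -/

/-- The constant `c` such that the search for a large component is stopped after discovering
`c * ε * n ^ j` sets. -/
noncomputable def giantDensity (k j : ℕ) : ℝ :=
  1 / (8 * 2 ^ k * degreeFactor k ^ j * k.factorial)

theorem giantDensity_pos (k j : ℕ) : 0 < giantDensity k j := by
  have h1 := one_le_degreeFactor k
  have h2 := Nat.factorial_pos k
  unfold giantDensity
  positivity

/-- The seeds: a family of at least `c * ε * n ^ j` sets of size `j`, obtained from
`exists_spread_family` with a set of about `2 * j! * c * ε * n` vertices. -/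
theorem exists_seed_family {k j n : ℕ} (hj : 1 ≤ j) (hjk : j < k) {ε : ℝ} (hε0 : 0 < ε)
    (hε1 : ε ≤ 1) (hjn : 2 * j ^ 2 ≤ n) (hn : 1 ≤ giantDensity k j * ε * n) :
    ∃ P : Finset (Finset (Fin n)), (∀ J ∈ P, J.card = j) ∧
      giantDensity k j * ε * (n : ℝ) ^ j ≤ P.card ∧
      ∀ L : Finset (Fin n), L.Nonempty → L.card < j → 8 * 2 ^ k * (upDegree P L : ℝ) ≤
        degreeThreshold (degreeFactor k) (giantDensity k j * ε * (n : ℝ) ^ j) n L.card := by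
  have hn1 : 1 ≤ n := le_trans (by nlinarith) hjn
  have hn0 : (0 : ℝ) < n := by exact_mod_cast hn1
  have : NeZero n := ⟨by omega⟩
  have hc0 := giantDensity_pos k j
  set c := giantDensity k j with hc
  have hK1 := one_le_degreeFactor k
  have hM1 : (1 : ℝ) ≤ 2 ^ k := one_le_pow₀ one_le_two
  have hf0 : (0 : ℝ) < k.factorial := by exact_mod_cast Nat.factorial_pos k
  have hjf0 : (1 : ℝ) ≤ j.factorial := by exact_mod_cast Nat.factorial_pos j
  have hfj : (j.factorial : ℝ) ≤ k.factorial := by exact_mod_cast Nat.factorial_le hjk.le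
  have hcf : 8 * (j.factorial * c) ≤ 1 := by
    rw [hc, giantDensity, mul_one_div, mul_div_assoc', div_le_one (by positivity)]
    have h1 : 1 ≤ degreeFactor k ^ j := one_le_pow₀ hK1
    calc 8 * (j.factorial : ℝ) ≤ 8 * 1 * 1 * k.factorial := by linarith
      _ ≤ 8 * 2 ^ k * degreeFactor k ^ j * k.factorial := by gcongr
  set w := ⌈2 * j.factorial * (c * ε * n)⌉₊ with hw
  have hw1 : 2 * j.factorial * (c * ε * n) ≤ w := Nat.le_ceil _
  have hw2 : (w : ℝ) ≤ 4 * j.factorial * (c * ε * n) := by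
    have h1 := (Nat.ceil_lt_add_one (by positivity : 0 ≤ 2 * j.factorial * (c * ε * n))).le
    rw [← hw] at h1
    nlinarith
  have hwn : w ≤ n := by
    have h1 : 4 * j.factorial * (c * ε * n) ≤ n := by
      calc _ = (8 * (j.factorial * c)) * (ε * n) / 2 := by ring
        _ ≤ 1 * (1 * n) / 2 := by gcongr
        _ ≤ n := by linarith
    exact_mod_cast hw2.trans h1
  obtain ⟨S, -, hS⟩ := Finset.exists_subset_card_eq (s := (Finset.univ : Finset (Fin n)))
    (n := w) (by simpa using hwn)
  obtain ⟨P, h1, h2, h3⟩ := exists_spread_family j S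
  rw [hS, Fintype.card_fin] at h2 h3
  refine ⟨P, h1, ?_, fun L hL hLj => ?_⟩
  · have h4 := le_choose_mul_factorial (j := 0) (Nat.zero_le j) (n := n) (k := j) (by nlinarith) hn1
    simp only [Nat.sub_zero] at h4
    have h5 : (1 : ℝ) / 2 ≤ 1 - j ^ 2 / n := by
      have : (j : ℝ) ^ 2 / n ≤ 1 / 2 := by
        rw [div_le_div_iff₀ hn0 two_pos]
        have : 2 * (j : ℝ) ^ 2 ≤ n := by exact_mod_cast hjn
        linarith
      linarith
    have h6 : (n : ℝ) ^ j * (1 / 2) ≤ (n.choose j : ℝ) * j.factorial :=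
      le_trans (by gcongr) h4
    have h7 : (n.choose j : ℝ) * w ≤ P.card * n := by exact_mod_cast h2
    have h8 : c * ε * (n : ℝ) ^ j * n ≤ P.card * n := by
      calc c * ε * (n : ℝ) ^ j * n = ((n : ℝ) ^ j * (1 / 2)) * (2 * (c * ε * n)) := by ring
        _ ≤ ((n.choose j : ℝ) * j.factorial) * (2 * (c * ε * n)) := by gcongr
        _ = (n.choose j : ℝ) * (2 * j.factorial * (c * ε * n)) := by ring
        _ ≤ (n.choose j : ℝ) * w := by gcongr
        _ ≤ _ := h7
    exact le_of_mul_le_mul_right h8 hn0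
  · have hL1 : 1 ≤ L.card := Finset.card_pos.2 hL
    have h4 : (upDegree P L : ℝ) ≤ (n : ℝ) ^ (j - 1 - L.card) * w := by exact_mod_cast h3 L hLj
    have h5 : (n : ℝ) ^ j = n ^ (j - 1 - L.card) * n * n ^ L.card := by
      rw [← pow_succ, ← pow_add]
      congr 1
      omega
    have hKM : 32 * 2 ^ k * (j.factorial : ℝ) ≤ degreeFactor k ^ L.card := by
      calc 32 * 2 ^ k * (j.factorial : ℝ) ≤ 64 * (2 ^ k) ^ 3 * k.factorial := by
            have : (2 : ℝ) ^ k ≤ (2 ^ k) ^ 3 := le_self_pow₀ hM1 (by norm_num)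
            gcongr
            norm_num
        _ = degreeFactor k ^ 1 := by rw [pow_one, degreeFactor]
        _ ≤ _ := pow_le_pow_right₀ hK1 hL1
    calc 8 * 2 ^ k * (upDegree P L : ℝ)
        ≤ 8 * 2 ^ k * ((n : ℝ) ^ (j - 1 - L.card) * (4 * j.factorial * (c * ε * n))) := by
          gcongr
          exact h4.trans (by gcongr)
      _ = (32 * 2 ^ k * (j.factorial : ℝ)) * (c * ε * ((n : ℝ) ^ (j - 1 - L.card) * n)) := by ring
      _ ≤ degreeFactor k ^ L.card * (c * ε * ((n : ℝ) ^ (j - 1 - L.card) * n)) := by gcongr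
      _ = _ := by
          rw [degreeThreshold, h5]
          field_simp

theorem card_filter_card_lt_le (n j : ℕ) (hn : 1 ≤ n) :
    ((Finset.univ.filter fun L : Finset (Fin n) => L.Nonempty ∧ L.card < j).card : ℝ) ≤
      j * (n : ℝ) ^ j := by
  have h1 : (Finset.univ.filter fun L : Finset (Fin n) => L.Nonempty ∧ L.card < j) ⊆
      (Finset.range j).biUnion fun i => Finset.powersetCard i Finset.univ := by
    intro L hL
    simp only [Finset.mem_filter, Finset.mem_univ, true_and] at hL
    simpa [Finset.mem_biUnion, Finset.mem_powersetCard] using hL.2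
  have h2 := (Finset.card_le_card h1).trans Finset.card_biUnion_le
  have h3 : ∑ i ∈ Finset.range j, (Finset.powersetCard i (Finset.univ : Finset (Fin n))).card ≤
      ∑ _i ∈ Finset.range j, n ^ j := by
    refine Finset.sum_le_sum fun i hi => ?_
    rw [Finset.card_powersetCard, Finset.card_univ, Fintype.card_fin]
    exact (Nat.choose_le_pow n i).trans
      (Nat.pow_le_pow_right hn (Finset.mem_range.1 hi).le)
  rw [Finset.sum_const, Finset.card_range, smul_eq_mul] at h3
  exact_mod_cast h2.trans h3

/-- An explicit bound on the probability that there is no large component: the first term bounds the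
degrees, the second one excludes running out of queries. -/
theorem no_giant_le {k j n : ℕ} (hj : 1 ≤ j) (hjk : j < k) {ε : ℝ} (hε0 : 0 < ε)
    (hε1 : ε ≤ 1 / (8 * 2 ^ k)) (p : unitInterval) (hp : (p : ℝ) = (1 + ε) * thresholdProb k j n)
    (hkn : 8 * (k : ℝ) ^ 2 ≤ ε * n) (hn : 8 * (2 ^ k) ^ 2 ≤ giantDensity k j * ε * n) :
    (setBernoulli (Set.univ : Set {e : Finset (Fin n) // e.card = k}) p).real
      {H | ¬ ∃ K ∈ UniformHypergraph.tupleComponents H j,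
        3 / 4 * (giantDensity k j * ε * (n : ℝ) ^ j) ≤ (K.ncard : ℝ)} ≤
      j * (n : ℝ) ^ j * Real.exp (-(giantDensity k j * ε * n / (64 * (2 ^ k) ^ 3))) +
      Real.exp (-(giantDensity k j / (256 * 2 ^ k) * (ε ^ 3 * (n : ℝ) ^ j))) := by
  have hM1 : (1 : ℝ) ≤ 2 ^ k := one_le_pow₀ one_le_two
  have hε2 : 1 / (8 * 2 ^ k) ≤ (1 : ℝ) / 8 :=
    one_div_le_one_div_of_le (by norm_num) (by linarith)
  have hε1' : ε ≤ 1 := by linarith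
  have hk1 : (1 : ℝ) ≤ (k : ℝ) := by exact_mod_cast (by omega : 1 ≤ k)
  have hn8 : 8 * (k : ℝ) ^ 2 ≤ n := hkn.trans (by
    have : (0 : ℝ) ≤ n := Nat.cast_nonneg n
    nlinarith)
  have hn8' : 8 * k ^ 2 ≤ n := by exact_mod_cast hn8
  have hkn' : k ≤ n := by nlinarith
  have hn1 : 1 ≤ n := by omega
  have hn0 : (0 : ℝ) < n := by exact_mod_cast hn1
  have hc0 := giantDensity_pos k j
  have hK1 := one_le_degreeFactor k
  have hf0 : (0 : ℝ) < k.factorial := by exact_mod_cast Nat.factorial_pos k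
  set B := giantDensity k j * ε * (n : ℝ) ^ j with hB
  have hB0 : 0 < B := by positivity
  set r : ℝ := ((k.choose j - 1 : ℕ) : ℝ) with hr
  have hr1 : 1 ≤ r := by
    have := two_le_choose hj hjk
    rw [hr]
    exact_mod_cast (by omega : 1 ≤ k.choose j - 1)
  have hrM : r ≤ 2 ^ k := by
    rw [hr]
    exact_mod_cast (Nat.sub_le _ _).trans (Nat.choose_le_two_pow k j)
  set f : ℝ := ((k - j).factorial : ℝ) with hf
  have hf1 : 1 ≤ f := by
    rw [hf]
    exact_mod_cast Nat.factorial_pos (k - j)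
  have hfk : f ≤ k.factorial := by
    rw [hf]
    exact_mod_cast Nat.factorial_le (Nat.sub_le _ _)
  have hpow : (n : ℝ) ^ k / (n : ℝ) ^ j = (n : ℝ) ^ (k - j) := by
    rw [div_eq_mul_inv, ← pow_sub₀ _ hn0.ne' hjk.le]
  have hp' : (p : ℝ) = (1 + ε) * (f / (r * (n : ℝ) ^ (k - j))) := by
    rw [hp, thresholdProb_eq hj hjk]
  obtain ⟨P, hP1, hP2, hP3⟩ := exists_seed_family (n := n) hj hjk hε0 hε1' (by nlinarith)
    (le_trans (by nlinarith) hn)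
  set N : ℝ := ((n - j).choose (k - j) : ℝ) with hN
  have hNle : N * f ≤ (n : ℝ) ^ (k - j) := choose_mul_factorial_le n j k
  have hNge : (n : ℝ) ^ (k - j) * (1 - k ^ 2 / n) ≤ N * f :=
    le_choose_mul_factorial hjk.le hkn' hn1
  have hbeta : ∀ i < j, giantDensity k j * ε * n ≤ degreeThreshold (degreeFactor k) B n i := by
    intro i hi
    rw [degreeThreshold, le_div_iff₀ (by positivity), hB]
    have h1 : (n : ℝ) * n ^ i ≤ n ^ j := by
      rw [← pow_succ']
      exact pow_le_pow_right₀ (by exact_mod_cast hn1) hi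
    have h2 : 1 ≤ degreeFactor k ^ i := one_le_pow₀ hK1
    calc giantDensity k j * ε * n * n ^ i = 1 * (giantDensity k j * ε * (n * n ^ i)) := by ring
      _ ≤ _ := by gcongr
  have main := giant_tail_le (V := Fin n) hj hjk (by rw [Fintype.card_fin]; omega) hB0 p hε0 hε1' hP1 hP2
    (by
      rw [Fintype.card_fin, hpow, ← hr, ← hN, hp']
      have h1 : 2 ^ j * (degreeFactor k ^ j * B / (n : ℝ) ^ j * (n : ℝ) ^ (k - j)) * f ≤
          (n : ℝ) ^ (k - j) * (ε / 8) := by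
        have h2 : (2 : ℝ) ^ j ≤ 2 ^ k := pow_le_pow_right₀ one_le_two hjk.le
        calc _ ≤ 2 ^ k * (degreeFactor k ^ j * B / (n : ℝ) ^ j * (n : ℝ) ^ (k - j)) *
              k.factorial := by gcongr
          _ = _ := by
            rw [hB, giantDensity]
            field_simp
      have h3 : (k : ℝ) ^ 2 / n ≤ ε / 8 := by
        rw [div_le_div_iff₀ hn0 (by norm_num)]
        linarith
      have h4 : (n : ℝ) ^ (k - j) * (1 - ε / 4) ≤
          (N - 2 ^ j * (degreeFactor k ^ j * B / (n : ℝ) ^ j * (n : ℝ) ^ (k - j))) * f := by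
        have h5 : (n : ℝ) ^ (k - j) * (k ^ 2 / n) ≤ (n : ℝ) ^ (k - j) * (ε / 8) := by gcongr
        linarith
      calc 1 + ε / 2 ≤ (1 + ε) * (1 - ε / 4) := by nlinarith
        _ = (1 + ε) / (n : ℝ) ^ (k - j) * ((n : ℝ) ^ (k - j) * (1 - ε / 4)) := by field_simp
        _ ≤ (1 + ε) / (n : ℝ) ^ (k - j) * _ := mul_le_mul_of_nonneg_left h4 (by positivity)
        _ = _ := by field_simp)
    (by
      rw [Fintype.card_fin, ← hr, ← hN, hp']
      calc _ = (1 + ε) * (N * f / (n : ℝ) ^ (k - j)) := by field_simp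
        _ ≤ (1 + ε) * 1 := by
            gcongr
            rw [div_le_one (by positivity)]
            exact hNle
        _ ≤ _ := by linarith)
    (by
      rw [Fintype.card_fin, hpow, hp']
      calc _ = (1 + ε) * (f / r) := by field_simp
        _ ≤ 2 * k.factorial := by
            have h1 : f / r ≤ k.factorial := (div_le_self (by linarith) hr1).trans hfk
            gcongr
            linarith)
    (by
      rw [Fintype.card_fin]
      exact fun i hi => hn.trans (hbeta i hi))
    (by
      rw [Fintype.card_fin]
      exact hP3)
  rw [Fintype.card_fin, ← hr] at main
  refine main.trans (add_le_add ?_ ?_)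
  · calc _ ≤ ∑ _L ∈ Finset.univ.filter (fun L : Finset (Fin n) => L.Nonempty ∧ L.card < j),
          Real.exp (-(giantDensity k j * ε * n / (64 * (2 ^ k) ^ 3))) := by
          refine Finset.sum_le_sum fun L hL => Real.exp_le_exp.2 (neg_le_neg ?_)
          rw [Finset.mem_filter] at hL
          exact div_le_div_of_nonneg_right (hbeta _ hL.2.2) (by positivity)
      _ ≤ _ := by
          rw [Finset.sum_const, nsmul_eq_mul]
          exact mul_le_mul_of_nonneg_right (card_filter_card_lt_le n j hn1) (Real.exp_pos _).le
  · refine Real.exp_le_exp.2 (neg_le_neg ?_)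
    calc giantDensity k j / (256 * 2 ^ k) * (ε ^ 3 * (n : ℝ) ^ j)
        ≤ giantDensity k j / (256 * r) * (ε ^ 3 * (n : ℝ) ^ j) := by gcongr
      _ = _ := by
          rw [hB]
          field_simp
          norm_num

/-! ### The limit in the supercritical regime -/

/-- A decreasing event becomes less likely as `p` grows. -/
theorem measureReal_antitone_prob {E : Type*} [Fintype E] {p p' : unitInterval} (hpp : p ≤ p')
    {D : Set (Set E)} (hD : IsLowerSet D) :
    (setBernoulli (Set.univ : Set E) p').real D ≤ (setBernoulli (Set.univ : Set E) p).real D := by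
  have hneg : ∀ q : ℝ, bernoulliSum q Finset.univ (fun H => -D.indicator (1 : Set E → ℝ) H) =
      -bernoulliSum q Finset.univ (D.indicator 1) := by
    intro q
    simp [bernoulliSum]
  have hmono : Monotone fun H => -D.indicator (1 : Set E → ℝ) H := by
    intro H H' h
    by_cases h1 : H' ∈ D
    · simp [h1, hD h h1]
    · by_cases h2 : H ∈ D <;> simp [h1, h2]
  have h := bernoulliSum_mono_prob p.2.1 (Subtype.coe_le_coe.2 hpp) p'.2.2
    (Finset.univ : Finset E) hmono
  rw [hneg, hneg] at h
  rw [setBernoulli_real_eq_bernoulliSum, setBernoulli_real_eq_bernoulliSum]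
  linarith

theorem isLowerSet_no_giant {V : Type*} [Fintype V] (k j : ℕ) (a : ℝ) :
    IsLowerSet {H : Set {e : Finset V // e.card = k} |
      ¬ ∃ K ∈ UniformHypergraph.tupleComponents H j, a ≤ (K.ncard : ℝ)} := by
  rintro (H' : UniformHypergraph V k) (H : UniformHypergraph V k) hHH hH'
  simp only [Set.mem_ofPred_eq] at hH' ⊢
  rintro ⟨K, ⟨J₀, rfl⟩, hK⟩
  refine hH' ⟨{x | (H'.tupleSetoid j) x J₀}, ⟨J₀, rfl⟩, hK.trans ?_⟩
  have hsub : {x | (H.tupleSetoid j) x J₀} ⊆ {x | (H'.tupleSetoid j) x J₀} := fun x hx =>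
    Relation.ReflTransGen.mono (fun J J' ⟨e, he, h⟩ => ⟨e, hHH he, h⟩) _ _ hx
  exact_mod_cast Set.ncard_le_ncard hsub (Set.toFinite _)

theorem tendsto_pow_mul_exp_neg_rpow (j : ℕ) {δ b : ℝ} (hδ : 0 < δ) (hb : 0 < b) :
    Tendsto (fun n : ℕ => (n : ℝ) ^ j * Real.exp (-(b * (n : ℝ) ^ δ))) atTop (𝓝 0) := by
  have h1 : Tendsto (fun n : ℕ => (n : ℝ) ^ δ) atTop atTop :=
    (tendsto_rpow_atTop hδ).comp tendsto_natCast_atTop_atTop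
  have h2 := (tendsto_rpow_mul_exp_neg_mul_atTop_nhds_zero ((j : ℝ) / δ) b hb).comp h1
  refine h2.congr fun n => ?_
  simp only [Function.comp_apply]
  rw [← Real.rpow_mul (Nat.cast_nonneg n), mul_div_cancel₀ _ hδ.ne', Real.rpow_natCast, neg_mul]

/-- Above the threshold there is a large component. By monotonicity, `ε` may be replaced by its
minimum with a small constant. -/
theorem holdsAAS_giant_component {k j : ℕ} (hj : 1 ≤ j) (hjk : j < k) {δ : ℝ} {ε : ℕ → ℝ}
    {p : ℕ → unitInterval} (hδ0 : 0 < δ) (hδ1 : δ < 1)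
    (hε : Tendsto (fun n : ℕ => ε n / ((n : ℝ) ^ (δ - 1) + (n : ℝ) ^ (-(j : ℝ) / 3))) atTop atTop)
    (hp : ∀ᶠ n in atTop, (p n : ℝ) = (1 + ε n) * thresholdProb k j n) :
    HoldsAAS k p (fun n H => ∃ K ∈ H.tupleComponents j,
      3 / 4 * giantDensity k j * (1 / (8 * 2 ^ k)) * (min (ε n) 1 * (n : ℝ) ^ j) ≤
        (K.ncard : ℝ)) := by
  have hM1 : (1 : ℝ) ≤ 2 ^ k := one_le_pow₀ one_le_two
  set ε₀ : ℝ := 1 / (8 * 2 ^ k) with hε₀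
  have hε₀0 : 0 < ε₀ := by positivity
  have hε₀1 : ε₀ ≤ 1 := by
    rw [hε₀, div_le_one (by positivity)]
    linarith
  have hc0 := giantDensity_pos k j
  set c := giantDensity k j with hc
  set ε' : ℕ → ℝ := fun n => min (ε n) ε₀ with hε'
  have hj0 : (0 : ℝ) < j := by exact_mod_cast hj
  -- any constant multiple of the two powers of `n` is eventually below `ε'`
  have hlow : ∀ A : ℝ, 0 ≤ A → ∀ᶠ n : ℕ in atTop,
      A * (n : ℝ) ^ (δ - 1) ≤ ε' n ∧ A * (n : ℝ) ^ (-(j : ℝ) / 3) ≤ ε' n := by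
    intro A hA
    have h1 : Tendsto (fun n : ℕ => A * (n : ℝ) ^ (δ - 1)) atTop (𝓝 0) := by
      have h := ((tendsto_rpow_neg_atTop (y := 1 - δ) (by linarith)).comp
        tendsto_natCast_atTop_atTop).const_mul A
      simpa [Function.comp_def] using h
    have h2 : Tendsto (fun n : ℕ => A * (n : ℝ) ^ (-(j : ℝ) / 3)) atTop (𝓝 0) := by
      have h := ((tendsto_rpow_neg_atTop (y := (j : ℝ) / 3) (by positivity)).comp
        tendsto_natCast_atTop_atTop).const_mul A
      simpa [Function.comp_def, neg_div] using h
    filter_upwards [hε.eventually_ge_atTop A, h1.eventually_le_const hε₀0,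
      h2.eventually_le_const hε₀0, eventually_ge_atTop 1] with n h3 h4 h5 h6
    have hn0 : (0 : ℝ) < n := by exact_mod_cast h6
    have h7 : 0 < (n : ℝ) ^ (δ - 1) := Real.rpow_pos_of_pos hn0 _
    have h8 : 0 < (n : ℝ) ^ (-(j : ℝ) / 3) := Real.rpow_pos_of_pos hn0 _
    rw [le_div_iff₀ (by positivity)] at h3
    have h9 := mul_nonneg hA h7.le
    have h10 := mul_nonneg hA h8.le
    exact ⟨le_min (by linarith) h4, le_min (by linarith) h5⟩
  have hεn : ∀ᶠ n : ℕ in atTop, (n : ℝ) ^ δ ≤ ε' n * n := by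
    filter_upwards [hlow 1 zero_le_one, eventually_ge_atTop 1] with n h1 h2
    have hn0 : (0 : ℝ) < n := by exact_mod_cast h2
    have h3 : (n : ℝ) ^ δ = (n : ℝ) ^ (δ - 1) * n := by
      rw [Real.rpow_sub_one hn0.ne']
      field_simp
    rw [h3]
    have := h1.1
    rw [one_mul] at this
    gcongr
  have hε3 : Tendsto (fun n : ℕ => ε' n ^ 3 * (n : ℝ) ^ j) atTop atTop := by
    rw [tendsto_atTop]
    intro b
    have hA : 1 ≤ max 1 b := le_max_left _ _
    filter_upwards [hlow (max 1 b) (by linarith), eventually_ge_atTop 1] with n h1 h2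
    have hn0 : (0 : ℝ) < n := by exact_mod_cast h2
    have h3 : ((n : ℝ) ^ (-(j : ℝ) / 3)) ^ 3 * (n : ℝ) ^ j = 1 := by
      rw [← Real.rpow_natCast, ← Real.rpow_mul hn0.le, ← Real.rpow_natCast,
        ← Real.rpow_add hn0]
      norm_num
    calc b ≤ max 1 b := le_max_right _ _
      _ ≤ max 1 b ^ 3 := le_self_pow₀ hA (by norm_num)
      _ = (max 1 b * (n : ℝ) ^ (-(j : ℝ) / 3)) ^ 3 * (n : ℝ) ^ j := by
          rw [mul_pow, mul_assoc, h3, mul_one]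
      _ ≤ _ := by
          have := h1.2
          gcongr
  have hnδ : Tendsto (fun n : ℕ => (n : ℝ) ^ δ) atTop atTop :=
    (tendsto_rpow_atTop hδ0).comp tendsto_natCast_atTop_atTop
  refine holdsAAS_of_eventually_le (b := fun n : ℕ =>
    j * ((n : ℝ) ^ j * Real.exp (-(c / (64 * (2 ^ k) ^ 3) * (n : ℝ) ^ δ))) +
      Real.exp (-(c / (256 * 2 ^ k) * (ε' n ^ 3 * (n : ℝ) ^ j)))) ?_ ?_
  · have h1 := (tendsto_pow_mul_exp_neg_rpow j (b := c / (64 * (2 ^ k) ^ 3)) hδ0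
      (by positivity)).const_mul (j : ℝ)
    have h2 := Real.tendsto_exp_neg_atTop_nhds_zero.comp
      (hε3.const_mul_atTop (by positivity : 0 < c / (256 * 2 ^ k)))
    simpa [Function.comp_def] using h1.add h2
  filter_upwards [hp, hεn, hnδ.eventually_ge_atTop (8 * (k : ℝ) ^ 2),
    hnδ.eventually_ge_atTop (8 * (2 ^ k) ^ 2 / c), eventually_ge_atTop 1] with n hpn h1 h2 h3 h4
  have hn0 : (0 : ℝ) < n := by exact_mod_cast h4
  have hε'0 : 0 < ε' n := by
    have h5 : 0 < ε' n * n := lt_of_lt_of_le (Real.rpow_pos_of_pos hn0 _) h1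
    exact pos_of_mul_pos_left h5 hn0.le
  have hε0 : 0 < ε n := lt_of_lt_of_le hε'0 (min_le_left _ _)
  have hth : 0 < thresholdProb k j n := by
    have h2c := two_le_choose hj hjk
    have hr : (0 : ℝ) < ((k.choose j - 1 : ℕ) : ℝ) := by
      exact_mod_cast (by omega : 0 < k.choose j - 1)
    rw [thresholdProb_eq hj hjk]
    have := Nat.factorial_pos (k - j)
    positivity
  have hle : (1 + ε' n) * thresholdProb k j n ≤ p n := by
    rw [hpn]
    have : ε' n ≤ ε n := min_le_left _ _
    gcongr
  set q : unitInterval := ⟨(1 + ε' n) * thresholdProb k j n, by positivity, hle.trans (p n).2.2⟩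
    with hq
  have hsub : {H : UniformHypergraph (Fin n) k | ¬ ∃ K ∈ H.tupleComponents j,
        3 / 4 * c * ε₀ * (min (ε n) 1 * (n : ℝ) ^ j) ≤ (K.ncard : ℝ)} ⊆
      {H | ¬ ∃ K ∈ UniformHypergraph.tupleComponents H j,
        3 / 4 * (c * ε' n * (n : ℝ) ^ j) ≤ (K.ncard : ℝ)} := by
    rintro H hH ⟨K, hK, hKc⟩
    refine hH ⟨K, hK, le_trans ?_ hKc⟩
    have h5 : ε₀ * min (ε n) 1 ≤ ε' n := by
      refine le_min ?_ ?_
      · calc ε₀ * min (ε n) 1 ≤ 1 * ε n := by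
              have : min (ε n) 1 ≤ ε n := min_le_left _ _
              have : 0 ≤ min (ε n) 1 := le_min hε0.le zero_le_one
              gcongr
          _ = ε n := one_mul _
      · calc ε₀ * min (ε n) 1 ≤ ε₀ * 1 := by
              have : min (ε n) 1 ≤ 1 := min_le_right _ _
              gcongr
          _ = ε₀ := mul_one _
    calc _ = 3 / 4 * (c * (ε₀ * min (ε n) 1) * (n : ℝ) ^ j) := by ring
      _ ≤ _ := by gcongr
  refine (measureReal_mono hsub (measure_ne_top _ _)).trans
    ((measureReal_antitone_prob (show q ≤ p n from hle) (isLowerSet_no_giant k j _)).trans ?_)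
  have h5 : 8 * (2 ^ k) ^ 2 ≤ c * ε' n * n := by
    rw [div_le_iff₀ hc0] at h3
    calc _ ≤ (n : ℝ) ^ δ * c := h3
      _ ≤ ε' n * n * c := by gcongr
      _ = _ := by ring
  refine (no_giant_le hj hjk hε'0 (min_le_right _ _) q rfl (h2.trans h1) h5).trans ?_
  have h6 : c / (64 * (2 ^ k) ^ 3) * (n : ℝ) ^ δ ≤ c * ε' n * n / (64 * (2 ^ k) ^ 3) := by
    calc _ ≤ c / (64 * (2 ^ k) ^ 3) * (ε' n * n) := by gcongr
      _ = _ := by ring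
  rw [mul_assoc]
  gcongr

theorem mainTheorem1 (k j : ℕ) (hj : 1 ≤ j) (hjk : j ≤ k - 1) :
    (∃ C : ℝ, 0 < C ∧
      ∀ (ε : ℕ → ℝ) (p : ℕ → unitInterval),
        (∀ᶠ n in atTop, 0 < ε n) →
        (∀ᶠ n in atTop, (p n : ℝ) = (1 - ε n) * thresholdProb k j n) →
        HoldsAAS k p (fun n H =>
          ∀ K ∈ H.tupleComponents j, (K.ncard : ℝ) ≤ C * ((ε n)⁻¹ ^ 2 * Real.log n))) ∧
    (∃ c : ℝ, 0 < c ∧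
      ∀ (δ : ℝ) (ε : ℕ → ℝ) (p : ℕ → unitInterval),
        0 < δ → δ < 1 →
        Tendsto (fun n : ℕ => ε n / ((n : ℝ) ^ (δ - 1) + (n : ℝ) ^ (-(j : ℝ) / 3)))
          atTop atTop →
        (∀ᶠ n in atTop, (p n : ℝ) = (1 + ε n) * thresholdProb k j n) →
        HoldsAAS k p (fun n H =>
          ∃ K ∈ H.tupleComponents j, c * (min (ε n) 1 * (n : ℝ) ^ j) ≤ (K.ncard : ℝ))) := by
  have hjk' : j < k := by omega
  have hr : (0 : ℝ) < ((k.choose j - 1 : ℕ) : ℝ) := by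
    have := two_le_choose hj hjk'
    exact_mod_cast (by omega : 0 < k.choose j - 1)
  have hc := giantDensity_pos k j
  exact ⟨⟨4 * ((k.choose j - 1 : ℕ) : ℝ) * (j + 1), by positivity,
      fun ε p hε hp => holdsAAS_small_components hj hjk' hε hp⟩,
    ⟨3 / 4 * giantDensity k j * (1 / (8 * 2 ^ k)), by positivity,
      fun δ ε p hδ0 hδ1 hε hp => holdsAAS_giant_component hj hjk' hδ0 hδ1 hε hp⟩⟩
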